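/- Let $d, l > 0$ and $u \in \mathbb{C}$, and let $\{\lambda_n\}_{n \ge 0}$ be a sequence of complex numbers such that $$\lambda_n = \rho_n^2, \qquad \rho_n = \frac{\pi n}{2l} + \frac{2}{d \pi n} + \frac{4 l \delta_n u}{\pi^2 n^2} + \frac{\mu_n}{n^2}, \qquad \delta_n = \sin\frac{\pi n}{2}, \qquad n \ge 1,$$ with some complex sequence $\{\mu_n\}_{n \ge 1} \in \ell_2$ (the number $\lambda_0 \in \mathbb{C}$ is arbitrary). Then the infinite product $$\Delta(\lambda) = l d^2 (\lambda - \lambda_0) \prod_{n=1}^\infty \frac{\lambda_n - \lambda}{\left(\frac{\pi n}{2l}\right)^2}$$ converges for every $\lambda \in \mathbb{C}$, and there exist a constant $C_0 \in \mathbb{C}$ and a complex-valued function $W \in L_2(0, 2l)$ such that, for all $\rho \in \mathbb{C}$ and $\lambda = \rho^2$, $$\Delta(\lambda) = \tilde\Delta(\lambda) + C_0 \frac{\sin 2\rho l}{\rho} + \int_0^{2l} W(t)\, \frac{\sin \rho t}{2\rho}\, dt, \qquad \tilde\Delta(\lambda) = \frac{d^2\rho}{2} \sin 2\rho l - d \cos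 2\rho l + d^2 u\, \frac{\sin \rho l}{\rho},$$ where $\frac{\sin \rho t}{\rho}$ is understood as its limit $t$ at $\rho = 0$. -/

import Mathlib

open MeasureTheory

noncomputable section

/-- The entire function of `ρ` given by `sin (ρ t) / ρ` for `ρ ≠ 0`; its value at `ρ = 0` is the
limit `t`. It is even in `ρ`, hence an entire function of `ρ ^ 2`. -/
def sinQuot (t : ℝ) (ρ : ℂ) : ℂ :=
  if ρ = 0 then (t : ℂ) else Complex.sin (ρ * t) / ρ

/-- `lam n = ρ_n ^ 2` for `n ≥ 1`, where
`ρ_n = π n / (2 l) + 2 / (d π n) + 4 l δ_n u / (π² n²) + μ_n / n²`, `δ_n = sin (π n / 2)`,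
with a square-summable complex sequence `μ`. Nothing is required of `lam 0`, and `μ 0` plays
no role. -/
def HasSpectralAsymptotics (d l : ℝ) (u : ℂ) (lam : ℕ → ℂ) : Prop :=
  ∃ μ : ℕ → ℂ, Memℓp μ 2 ∧ ∀ n : ℕ, 1 ≤ n →
    lam n = ((Real.pi : ℂ) * n / (2 * l) + 2 / (d * Real.pi * n)
      + 4 * l * (Real.sin (Real.pi * n / 2) : ℂ) * u / ((Real.pi : ℂ) ^ 2 * (n : ℂ) ^ 2)
      + μ n / (n : ℂ) ^ 2) ^ 2

/-- The factor `(lam n - z) / (π n / (2 l))²` with index `n = k + 1`, so that `k` runs through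
`0, 1, 2, …` when `n` runs through `1, 2, 3, …`. -/
def prodFactor (l : ℝ) (lam : ℕ → ℂ) (z : ℂ) (k : ℕ) : ℂ :=
  (lam (k + 1) - z) / ((Real.pi : ℂ) * ((k + 1 : ℕ) : ℂ) / (2 * l)) ^ 2

/-- `Δ(z) = l d² (z - lam 0) ∏_{n ≥ 1} (lam n - z) / (π n / (2 l))²`. -/
def prodDelta (d l : ℝ) (lam : ℕ → ℂ) (z : ℂ) : ℂ :=
  l * d ^ 2 * (z - lam 0) * ∏' k : ℕ, prodFactor l lam z k

/-- `(d² ρ / 2) sin 2ρl - d cos 2ρl + d² u sin ρl / ρ`, the value of `Δ̃` at `ρ ^ 2`. -/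
def tildeDelta (d l : ℝ) (u : ℂ) (ρ : ℂ) : ℂ :=
  d ^ 2 * ρ / 2 * Complex.sin (2 * ρ * l) - d * Complex.cos (2 * ρ * l)
    + d ^ 2 * u * sinQuot l ρ

end

/-!
Put `ν_n = π n / (2 l)` and `ρ = π x / (2 l)`. If every `lam n` were `ν_n²`, the product would be
Euler's product for `sin (2 ρ l) / (2 ρ l) = sin (π x) / (π x)`. Away from its zeros, `Δ (ρ²)` is
this sine times `(ρ² - lam 0) ∏ (1 + a_n / (ν_n² - ρ²))`, where `a_n = lam n - ν_n² = 2 / (d l) +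
4 u δ_n / (π n) + κ_n / n` with `κ ∈ ℓ²` (`exists_eq_of_hasSpectralAsymptotics`).

Expand the second product in partial fractions. Its residue at `ν_n²` is `a_n` times
`∏_{m ≠ n} (1 + a_m / (ν_m² - ν_n²))`, up to sign, and the latter product is `1 + O(n ^ (-7 / 4))`
(`exists_prod_bound`): its first-order term is governed by `∑_{m ≠ n} 1 / (m² - n²) = 3 / (4 n²)`,
and its higher-order terms are absolutely small. So the residues have the same form as the `a_n`,
with another sequence `ε ∈ ℓ²` in place of `κ`. Finite partial fractions and dominated convergence
give the expansion (`exists_tendsto_prod_partial_fraction`), and its three parts are summed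
separately (`exists_prod_remainder`). The constant part of the residues gives a cotangent, hence
`-d cos (2 ρ l)`. The part `δ_n / n` gives `sin (π x / 2) / sin (π x)`, hence the term with `u`.
Both expansions come from the Fourier series of `cos (x t)`. The `ℓ²` part is a sine series: since
`∫ sin (ν_n t) sin (ρ t) dt = (-1)^n ν_n sin (2 ρ l) / (ρ² - ν_n²)` over `(0, 2 l)`, it is the
pairing of `sin (ρ t)` with a function `W ∈ L²(0, 2 l)` whose sine coefficients are a multiple of
`± ε_n` (`exists_memLp_hasSum_sine`). All constants left over multiply `sin (2 ρ l) / ρ` and form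
`C₀`.

Both sides of the resulting identity are continuous in `ρ`, and the zeros of the sine are
countable, so it extends to all `ρ`.
-/

open Filter Topology Finset

/-! ### Elementary facts about the nodes and about square-summable sequences -/

theorem norm_natCast_add_one (k : ℕ) : ‖(k : ℂ) + 1‖ = (k : ℝ) + 1 := by
  rw [← Nat.cast_add_one, Complex.norm_natCast, Nat.cast_add_one]

theorem norm_inv_natCast_add_one (k : ℕ) : ‖((k : ℂ) + 1)⁻¹‖ = ((k : ℝ) + 1)⁻¹ := by
  rw [norm_inv, norm_natCast_add_one]

theorem inv_natCast_add_one_le_one (k : ℕ) : ((k : ℝ) + 1)⁻¹ ≤ 1 :=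
  inv_le_one_of_one_le₀ (by linarith [Nat.cast_nonneg (α := ℝ) k])

theorem inv_sq_le_rpow (n : ℕ) : (((n : ℝ) + 1) ^ 2)⁻¹ ≤ ((n : ℝ) + 1) ^ (-(7 / 4) : ℝ) := by
  calc (((n : ℝ) + 1) ^ 2)⁻¹ = ((n : ℝ) + 1) ^ (-2 : ℝ) := by
        rw [Real.rpow_neg (by positivity)]; norm_cast
    _ ≤ _ := Real.rpow_le_rpow_of_exponent_le (by linarith [Nat.cast_nonneg (α := ℝ) n])
        (by norm_num)

theorem natCast_add_one_sq_injective : Function.Injective fun n : ℕ => ((n : ℂ) + 1) ^ 2 := by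
  intro m n h
  have h' : (m + 1) ^ 2 = (n + 1) ^ 2 := by
    simp only at h
    exact_mod_cast h
  have := Nat.pow_left_injective two_ne_zero h'
  omega

theorem summable_inv_add_one_sq : Summable fun n : ℕ => (((n : ℝ) + 1) ^ 2)⁻¹ := by
  simpa using! (summable_nat_add_iff 1).2 (Real.summable_one_div_nat_pow.2 one_lt_two)

theorem complex_cos_nat_mul_pi (n : ℕ) : Complex.cos (n * Real.pi) = (-1) ^ n := by
  have h := congrArg ((↑) : ℝ → ℂ) (Real.cos_nat_mul_pi n)
  push_cast at h
  exact h

theorem complex_sin_add_int_mul_pi (x : ℂ) (n : ℤ) :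
    Complex.sin (x + n * Real.pi) = (-1) ^ n * Complex.sin x :=
  n.cast_negOnePow ℂ ▸ Complex.sin_antiperiodic.add_int_mul_eq n

theorem sin_pi_mul_ne_zero_iff {x : ℂ} : Complex.sin (Real.pi * x) ≠ 0 ↔ ∀ n : ℤ, x ≠ n := by
  have hpi : (Real.pi : ℂ) ≠ 0 := by exact_mod_cast Real.pi_ne_zero
  rw [Complex.sin_ne_zero_iff]
  refine forall_congr' fun n => not_congr ?_
  rw [mul_comm, mul_left_inj' hpi]

theorem sq_natCast_add_one_ne_sq {x : ℂ} (hx : ∀ n : ℤ, x ≠ n) (k : ℕ) :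
    ((k : ℂ) + 1) ^ 2 ≠ x ^ 2 := fun h => by
  rcases sq_eq_sq_iff_eq_or_eq_neg.1 h with h | h
  · exact hx (k + 1) (by push_cast; exact h.symm)
  · exact hx (-(k + 1)) (by push_cast; rw [h, neg_neg])

theorem norm_sin_mul_half_pi_le_one (k : ℕ) :
    ‖Complex.sin (((k : ℂ) + 1) * (Real.pi / 2))‖ ≤ 1 := by
  have : ((k : ℂ) + 1) * (Real.pi / 2) = (((k + 1) * (Real.pi / 2) : ℝ) : ℂ) := by
    push_cast; ring
  rw [this, ← Complex.ofReal_sin, Complex.norm_real]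
  exact Real.abs_sin_le_one _

theorem memℓp_two_iff {f : ℕ → ℂ} : Memℓp f 2 ↔ Summable fun n => ‖f n‖ ^ 2 := by
  rw [memℓp_gen_iff (by norm_num)]
  simp

theorem exists_norm_le_of_memℓp_two {f : ℕ → ℂ} (hf : Memℓp f 2) : ∃ C, ∀ n, ‖f n‖ ≤ C := by
  obtain ⟨C, hC⟩ := memℓp_infty_iff.1 (hf.of_exponent_ge le_top)
  exact ⟨C, fun n => hC ⟨n, rfl⟩⟩

theorem norm_le_of_norm_sub_le {α : ℕ → ℂ} {A : ℂ} {B : ℝ}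
    (hα : ∀ m, ‖α m - A‖ ≤ B * (m + 1 : ℝ)⁻¹) (m : ℕ) : ‖α m‖ ≤ ‖A‖ + B := by
  have hB : 0 ≤ B := by simpa using (norm_nonneg _).trans (hα 0)
  have h2 := norm_add_le (α m - A) A
  rw [sub_add_cancel] at h2
  have := mul_le_mul_of_nonneg_left (inv_natCast_add_one_le_one m) hB
  linarith [hα m]

/-! ### Finite products, partial fractions and sums over differences of squares -/

/-- The partial fraction decomposition of a finite product with simple poles. The factor `m = n` of
the inner product is `1`, because `s n - s n = 0` and division by zero gives zero. -/
theorem prod_one_add_div_eq_partial_fraction {K : Type*} [Field K] {s a : ℕ → K}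
    (hs : Function.Injective s) (N : ℕ) {z : K} (hz : ∀ n < N, s n ≠ z) :
    ∏ n ∈ range N, (1 + a n / (s n - z)) =
      1 + ∑ n ∈ range N,
        a n * (∏ m ∈ range N, (1 + a m / (s m - s n))) / (s n - z) := by
  induction N generalizing z with
  | zero => simp
  | succ N ih =>
    have hzN : s N - z ≠ 0 := sub_ne_zero.2 (hz N (Nat.lt_succ_self N))
    have ih1 := ih (z := z) fun n hn => hz n (hn.trans (Nat.lt_succ_self N))
    have ih2 := ih (z := s N) fun n hn h => hn.ne (hs h)
    rw [prod_range_succ, sum_range_succ, ih1,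
      prod_range_succ (n := N) (f := fun m => 1 + a m / (s m - s N)), ih2]
    simp only [sub_self, div_zero, add_zero, mul_one]
    -- Each old pole splits off a multiple of the new one; by `ih2` these multiples add up to the
    -- new residue.
    have key : ∀ n ∈ range N,
        a n * (∏ m ∈ range (N + 1), (1 + a m / (s m - s n))) / (s n - z) =
        a n * (∏ m ∈ range N, (1 + a m / (s m - s n))) / (s n - z) * (1 + a N / (s N - z))
        - a n * (∏ m ∈ range N, (1 + a m / (s m - s n))) / (s n - s N) * (a N / (s N - z)) := by
      intro n hn
      have hn' := mem_range.1 hn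
      have h1 : s n - z ≠ 0 := sub_ne_zero.2 (hz n (hn'.trans (Nat.lt_succ_self N)))
      have h2 : s n - s N ≠ 0 := sub_ne_zero.2 fun h => hn'.ne (hs h)
      have h3 : s N - s n ≠ 0 := sub_ne_zero.2 fun h => hn'.ne (hs h).symm
      rw [prod_range_succ]
      have h4 : a N / (s N - s n) = - (a N / (s n - s N)) := by
        rw [← neg_sub, div_neg]
      rw [h4]
      field_simp
      ring
    rw [sum_congr rfl key, sum_sub_distrib, ← sum_mul, ← sum_mul]
    ring

/-- The second-order companion of `Finset.norm_prod_one_add_sub_one_le`. -/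
theorem norm_prod_one_add_sub_one_sub_sum_le {ι : Type*} (t : Finset ι) (x : ι → ℂ) :
    ‖∏ i ∈ t, (1 + x i) - 1 - ∑ i ∈ t, x i‖ ≤
      Real.exp (∑ i ∈ t, ‖x i‖) - 1 - ∑ i ∈ t, ‖x i‖ := by
  classical
  induction t using Finset.induction_on with
  | empty => simp
  | insert i t hi ih =>
    have h1 := t.norm_prod_one_add_sub_one_le x
    rw [prod_insert hi, sum_insert hi, sum_insert hi]
    set P := ∏ i ∈ t, (1 + x i)
    set S := ∑ i ∈ t, ‖x i‖
    have h2 : (1 + x i) * P - 1 - (x i + ∑ i ∈ t, x i) =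
      (P - 1 - ∑ i ∈ t, x i) + x i * (P - 1) := by ring
    have h3 : ‖x i * (P - 1)‖ ≤ ‖x i‖ * (Real.exp S - 1) := by
      rw [norm_mul]; gcongr
    have h4 : (1 + ‖x i‖) * Real.exp S ≤ Real.exp (‖x i‖ + S) := by
      rw [Real.exp_add]
      gcongr
      linarith [Real.add_one_le_exp ‖x i‖]
    rw [h2]
    refine (norm_add_le _ _).trans ?_
    linarith

/-- Quadratic in `x`, which is what makes the second-order terms of the products negligible. -/
theorem exp_sub_one_sub_le {x : ℝ} (hx : 0 ≤ x) : Real.exp x - 1 - x ≤ x ^ 2 * Real.exp x := by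
  have h1 := Real.one_sub_le_exp_neg x
  have h2 : Real.exp x * Real.exp (-x) = 1 := by rw [← Real.exp_add]; simp
  have h3 := Real.exp_pos x
  have h4 : Real.exp x * (1 - x) ≤ 1 := by
    linarith [mul_le_mul_of_nonneg_left h1 h3.le]
  have h5 : Real.exp x - 1 ≤ x * Real.exp x := by linarith
  nlinarith

/-- A bound uniform in both the shift and the length; the term `m = n` is `0 ^ (-p) = 0`. -/
theorem exists_sum_abs_sub_rpow_le {p : ℝ} (hp : 1 < p) :
    ∃ C : ℝ, ∀ n K : ℕ, ∑ m ∈ range K, |(m : ℝ) - n| ^ (-p) ≤ C := by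
  have hsum : Summable fun j : ℤ => |(j : ℝ)| ^ (-p) := Real.summable_abs_int_rpow hp
  refine ⟨∑' j : ℤ, |(j : ℝ)| ^ (-p), fun n K => ?_⟩
  have hinj : Function.Injective fun m : ℕ => (m : ℤ) - n := fun x y h => by
    simpa using h
  have h := hsum.sum_le_tsum ((range K).map ⟨_, hinj⟩) fun _ _ => by positivity
  simpa using h

/-- Induction on `N`: the difference of the sums for `N + 1` and `N` telescopes in `m`. The
convention `0⁻¹ = 0` deletes the term `m + 1 = N` and is consistent with both the telescoping and
the value `0` at `N = 0`. -/
theorem tendsto_sum_inv_sub_inv (N : ℕ) :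
    Tendsto (fun K : ℕ => ∑ m ∈ range K, (((m + 1 : ℝ) - N)⁻¹ - ((m + 1 : ℝ) + N)⁻¹)) atTop
      (𝓝 (N : ℝ)⁻¹) := by
  induction N with
  | zero => simp
  | succ N ih =>
    have hlim : ∀ c : ℝ, Tendsto (fun K : ℕ => ((K : ℝ) + c)⁻¹) atTop (𝓝 0) := fun c =>
      tendsto_inv_atTop_zero.comp (tendsto_atTop_add_const_right _ _ tendsto_natCast_atTop_atTop)
    have h := (ih.add ((hlim (-N)).neg.add (hlim (N + 1)).neg)).add_const
      (-(N : ℝ)⁻¹ + (N + 1 : ℝ)⁻¹)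
    have e : (N : ℝ)⁻¹ + (-0 + -0) + (-(N : ℝ)⁻¹ + (N + 1 : ℝ)⁻¹) = ((N + 1 : ℕ) : ℝ)⁻¹ := by
      push_cast; ring
    rw [e] at h
    refine h.congr fun K => ?_
    have t1 := Finset.sum_range_sub (fun m : ℕ => -((m : ℝ) - N)⁻¹) K
    have t2 := Finset.sum_range_sub (fun m : ℕ => -((m : ℝ) + (N + 1))⁻¹) K
    have e1 : -((((0 : ℕ) : ℝ)) - N)⁻¹ = (N : ℝ)⁻¹ := by
      rw [Nat.cast_zero, zero_sub, inv_neg, neg_neg]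
    have e2 : -((((0 : ℕ) : ℝ)) + (N + 1))⁻¹ = -(N + 1 : ℝ)⁻¹ := by
      rw [Nat.cast_zero, zero_add]
    rw [e1] at t1; rw [e2] at t2
    have : ∑ m ∈ range K, (((m + 1 : ℝ) - (N + 1 : ℕ))⁻¹ - ((m + 1 : ℝ) + (N + 1 : ℕ))⁻¹) =
      ∑ m ∈ range K, (((m + 1 : ℝ) - N)⁻¹ - ((m + 1 : ℝ) + N)⁻¹) +
      ∑ i ∈ range K, (-((((i + 1 : ℕ)) : ℝ) - N)⁻¹ - -((i : ℝ) - N)⁻¹) +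
      ∑ i ∈ range K, (-((((i + 1 : ℕ)) : ℝ) + (N + 1))⁻¹ - -((i : ℝ) + (N + 1))⁻¹) := by
      rw [← sum_add_distrib, ← sum_add_distrib]
      refine sum_congr rfl fun m _ => ?_
      push_cast
      rw [show (m + 1 : ℝ) - (N + 1) = m - N by ring, show (m + 1 : ℝ) + N = m + (N + 1) by ring]
      ring
    rw [this, t1, t2, ← sub_eq_add_neg]
    ring

/-- `∑_{M ≠ N} 1 / (M² - N²) = 3 / (4 N²)`, where `N = n + 1` and `M = m + 1`; the term `m = n` is
`0⁻¹ = 0`. The cancellation matters: the sum of the absolute values is of order `log N / N`. -/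
theorem tendsto_sum_inv_sq_sub_sq (n : ℕ) :
    Tendsto (fun K : ℕ => ∑ m ∈ range K, ((m + 1 : ℝ) ^ 2 - (n + 1) ^ 2)⁻¹) atTop
      (𝓝 (3 / (4 * (n + 1 : ℝ) ^ 2))) := by
  have hn : (n + 1 : ℝ) ≠ 0 := by positivity
  have h := (tendsto_sum_inv_sub_inv (n + 1)).add_const ((2 * (n + 1 : ℝ))⁻¹)
  have h' := h.const_mul ((2 * (n + 1 : ℝ))⁻¹)
  have e : (2 * (n + 1 : ℝ))⁻¹ * (((n + 1 : ℕ) : ℝ)⁻¹ + (2 * (n + 1 : ℝ))⁻¹) =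
      3 / (4 * (n + 1 : ℝ) ^ 2) := by
    push_cast; field_simp; norm_num
  rw [e] at h'
  refine h'.congr' ?_
  filter_upwards [eventually_gt_atTop n] with K hK
  have key : ∀ m ∈ range K, ((m + 1 : ℝ) ^ 2 - (n + 1) ^ 2)⁻¹ = (2 * (n + 1 : ℝ))⁻¹ *
      ((((m + 1 : ℝ) - (n + 1 : ℕ))⁻¹ - ((m + 1 : ℝ) + (n + 1 : ℕ))⁻¹)
        + if m = n then (2 * (n + 1 : ℝ))⁻¹ else 0) := by
    intro m _
    push_cast
    split_ifs with hmn
    · subst hmn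
      rw [sub_self, sub_self, ← two_mul]; simp
    · have h1 : (m : ℝ) - n ≠ 0 := sub_ne_zero.2 (by exact_mod_cast hmn)
      have h2 : (m : ℝ) + 1 + (n + 1) ≠ 0 := by positivity
      rw [show (m + 1 : ℝ) ^ 2 - (n + 1) ^ 2 = (m - n) * (m + 1 + (n + 1)) by ring,
        show (m + 1 : ℝ) - (n + 1) = m - n by ring]
      field_simp
      ring
  rw [sum_congr rfl key, ← mul_sum, sum_add_distrib, sum_ite_eq' (range K) n,
    if_pos (mem_range.2 hK)]

/-! ### Products over differences of squares -/

/-- From `M + N ≥ N` and `M + N ≥ |M - N|`. Both sides vanish at `m = n`. -/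
theorem abs_inv_sq_sub_sq_le (m n : ℕ) :
    |((m + 1 : ℝ) ^ 2 - (n + 1) ^ 2)⁻¹| ≤
      (n + 1 : ℝ) ^ (-(7 / 8) : ℝ) * |(m : ℝ) - n| ^ (-(9 / 8) : ℝ) := by
  rcases eq_or_ne m n with rfl | hmn
  · simp
  have hD : 0 < |(m : ℝ) - n| := abs_pos.2 (sub_ne_zero.2 (by exact_mod_cast hmn))
  have hN : 0 < (n + 1 : ℝ) := by positivity
  have hm : 0 ≤ (m : ℝ) := by positivity
  have hn : 0 ≤ (n : ℝ) := by positivity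
  have hK : 0 < (m + 1 : ℝ) + (n + 1) := by positivity
  have hDK : |(m : ℝ) - n| ≤ (m + 1 : ℝ) + (n + 1) := by
    rw [abs_le]; constructor <;> linarith
  rw [Real.rpow_neg hN.le, Real.rpow_neg hD.le, ← mul_inv, abs_inv,
    show (m + 1 : ℝ) ^ 2 - (n + 1) ^ 2 = ((m + 1 : ℝ) + (n + 1)) * (m - n) by ring, abs_mul,
    abs_of_pos hK]
  have hNK : (n + 1 : ℝ) ^ (7 / 8 : ℝ) ≤ ((m + 1 : ℝ) + (n + 1)) ^ (7 / 8 : ℝ) :=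
    Real.rpow_le_rpow hN.le (by linarith) (by norm_num)
  refine inv_anti₀ (by positivity) ?_
  calc (n + 1 : ℝ) ^ (7 / 8 : ℝ) * |(m : ℝ) - n| ^ (9 / 8 : ℝ)
      = (n + 1 : ℝ) ^ (7 / 8 : ℝ) * |(m : ℝ) - n| ^ (1 / 8 : ℝ) * |(m : ℝ) - n| := by
        rw [mul_assoc, ← Real.rpow_add_one hD.ne']; norm_num
    _ ≤ ((m + 1 : ℝ) + (n + 1)) ^ (7 / 8 : ℝ) * ((m + 1 : ℝ) + (n + 1)) ^ (1 / 8 : ℝ)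
        * |(m : ℝ) - n| := by
        gcongr
    _ = ((m + 1 : ℝ) + (n + 1)) * |(m : ℝ) - n| := by
        rw [← Real.rpow_add hK]; norm_num

/-- The larger of `x` and `y` is at least `N / 2`; its power `3 / 4` pays for `N ^ (-3 / 4)`, and
what remains dominates the power `1 / 4` of the smaller one. -/
theorem inv_mul_le_of_le_add {x y N : ℝ} (hx : 0 < x) (hy : 0 < y) (hN : 0 < N) (h : N ≤ x + y) :
    (x * y)⁻¹ ≤ 2 * N ^ (-(3 / 4) : ℝ) * (x ^ (-(5 / 4) : ℝ) + y ^ (-(5 / 4) : ℝ)) := by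
  wlog hxy : x ≤ y generalizing x y
  · have := this hy hx (by linarith) (by linarith)
    rwa [mul_comm y x, add_comm (y ^ _)] at this
  have h1 : (x * y)⁻¹ ≤ 2 * N ^ (-(3 / 4) : ℝ) * x ^ (-(5 / 4) : ℝ) := by
    have h2 : N ^ (3 / 4 : ℝ) * x ^ (5 / 4 : ℝ) ≤ 2 * (x * y) := by
      have e1 : (2 : ℝ) ^ (3 / 4 : ℝ) ≤ 2 := by
        conv_rhs => rw [← Real.rpow_one 2]
        exact Real.rpow_le_rpow_of_exponent_le (by norm_num) (by norm_num)
      calc N ^ (3 / 4 : ℝ) * x ^ (5 / 4 : ℝ) ≤ (2 * y) ^ (3 / 4 : ℝ) * (x * x ^ (1 / 4 : ℝ)) := by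
            rw [mul_comm x, ← Real.rpow_add_one hx.ne']
            norm_num
            gcongr
            linarith
        _ ≤ (2 * y) ^ (3 / 4 : ℝ) * (x * y ^ (1 / 4 : ℝ)) := by gcongr
        _ = 2 ^ (3 / 4 : ℝ) * (x * (y ^ (3 / 4 : ℝ) * y ^ (1 / 4 : ℝ))) := by
            rw [Real.mul_rpow (by norm_num) hy.le]; ring
        _ ≤ 2 * (x * y) := by
            rw [← Real.rpow_add hy]; norm_num; gcongr
    rw [Real.rpow_neg hN.le, Real.rpow_neg hx.le, mul_assoc, ← mul_inv, ← div_eq_mul_inv,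
      inv_eq_one_div, div_le_div_iff₀ (by positivity) (by positivity), one_mul]
    exact h2
  refine h1.trans ?_
  gcongr
  have : 0 ≤ y ^ (-(5 / 4) : ℝ) := by positivity
  linarith

theorem inv_mul_abs_inv_sq_sub_sq_le (m n : ℕ) :
    (m + 1 : ℝ)⁻¹ * |((m + 1 : ℝ) ^ 2 - (n + 1) ^ 2)⁻¹| ≤
      2 * (n + 1 : ℝ) ^ (-(7 / 4) : ℝ) *
        ((m + 1 : ℝ) ^ (-(5 / 4) : ℝ) + |(m : ℝ) - n| ^ (-(5 / 4) : ℝ)) := by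
  rcases eq_or_ne m n with rfl | hmn
  · simp; positivity
  have hD : 0 < |(m : ℝ) - n| := abs_pos.2 (sub_ne_zero.2 (by exact_mod_cast hmn))
  have hN : 0 < (n + 1 : ℝ) := by positivity
  have hM : 0 < (m + 1 : ℝ) := by positivity
  have hK : 0 < (m + 1 : ℝ) + (n + 1) := by positivity
  have h := inv_mul_le_of_le_add hM hD hN (by linarith [neg_abs_le ((m : ℝ) - n)])
  rw [show (m + 1 : ℝ) ^ 2 - (n + 1) ^ 2 = ((m + 1 : ℝ) + (n + 1)) * (m - n) by ring, abs_inv,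
    abs_mul, abs_of_pos hK, mul_inv]
  have hNK : ((m + 1 : ℝ) + (n + 1))⁻¹ ≤ (n + 1 : ℝ)⁻¹ := inv_anti₀ hN (by linarith)
  calc (m + 1 : ℝ)⁻¹ * (((m + 1 : ℝ) + (n + 1))⁻¹ * |(m : ℝ) - n|⁻¹)
      = ((m + 1 : ℝ) + (n + 1))⁻¹ * ((m + 1 : ℝ) * |(m : ℝ) - n|)⁻¹ := by rw [mul_inv]; ring
    _ ≤ (n + 1 : ℝ)⁻¹ * (2 * (n + 1 : ℝ) ^ (-(3 / 4) : ℝ) *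
        ((m + 1 : ℝ) ^ (-(5 / 4) : ℝ) + |(m : ℝ) - n| ^ (-(5 / 4) : ℝ))) := by
        gcongr
    _ = _ := by
        rw [show (-(7 / 4) : ℝ) = -(3 / 4) + (-1) by norm_num, Real.rpow_add hN, Real.rpow_neg_one]
        ring

/-- If `a m = A + O(1 / m)`, the products `∏ (1 + a m / (M² - N²))` are bounded, and their limits
are `1 + O(N ^ (-7 / 4))`. The terms of order two and higher are at most a constant times the
square of the sum of the absolute values, and that sum is `O(N ^ (-7 / 8))`. In the sum of the
first-order terms the constant part `A` gives `3 A / (4 N²)` by `tendsto_sum_inv_sq_sub_sq`, and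
the part `O(1 / m)` converges absolutely to `O(N ^ (-7 / 4))`. The exponents are not sharp; the
use made of them needs more than `3 / 2`. -/
theorem exists_prod_bound {a : ℕ → ℂ} {A : ℂ} {B : ℝ} (ha : ∀ m, ‖a m - A‖ ≤ B * (m + 1 : ℝ)⁻¹) :
    ∃ C : ℝ, (∀ n K : ℕ, ‖∏ m ∈ range K, (1 + a m / ((m + 1 : ℂ) ^ 2 - (n + 1) ^ 2))‖ ≤ C) ∧
      ∀ n : ℕ, ∃ P : ℂ, Tendsto
        (fun K => ∏ m ∈ range K, (1 + a m / ((m + 1 : ℂ) ^ 2 - (n + 1) ^ 2))) atTop (𝓝 P) ∧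
        ‖P - 1‖ ≤ C * (n + 1 : ℝ) ^ (-(7 / 4) : ℝ) := by
  have hB : 0 ≤ B := by simpa using (norm_nonneg _).trans (ha 0)
  obtain ⟨C₁, hC₁⟩ := exists_sum_abs_sub_rpow_le (p := 9 / 8) (by norm_num)
  obtain ⟨C₂, hC₂⟩ := exists_sum_abs_sub_rpow_le (p := 5 / 4) (by norm_num)
  have hC₁0 : 0 ≤ C₁ := by simpa using hC₁ 0 0
  have hC₂0 : 0 ≤ C₂ := by simpa using hC₂ 0 0
  have hC₃ : ∀ K, ∑ m ∈ range K, (m + 1 : ℝ) ^ (-(5 / 4) : ℝ) ≤ C₂ := fun K => by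
    refine le_trans ?_ (hC₂ 0 (K + 1))
    rw [sum_range_succ']
    refine le_add_of_le_of_nonneg (sum_le_sum fun m _ => ?_) (by positivity)
    have h : |((m + 1 : ℕ) : ℝ) - (0 : ℕ)| = m + 1 := by
      push_cast; rw [sub_zero, abs_of_pos (by positivity)]
    rw [h]
  set q : ℕ → ℕ → ℝ := fun n m => ((m + 1 : ℝ) ^ 2 - (n + 1) ^ 2)⁻¹ with hq
  set x : ℕ → ℕ → ℂ := fun n m => a m / ((m + 1 : ℂ) ^ 2 - (n + 1) ^ 2) with hx
  have hxq : ∀ n m, x n m = a m * (q n m : ℂ) := fun n m => by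
    simp only [hx, hq]; push_cast; rfl
  set D := ‖A‖ + B
  have haD : ∀ m, ‖a m‖ ≤ D := norm_le_of_norm_sub_le ha
  have hD0 : 0 ≤ D := by positivity
  have hN1 : ∀ n : ℕ, (n + 1 : ℝ) ^ (-(7 / 8) : ℝ) ≤ 1 := fun n =>
    Real.rpow_le_one_of_one_le_of_nonpos (by linarith [Nat.cast_nonneg (α := ℝ) n]) (by norm_num)
  have hS : ∀ n K, ∑ m ∈ range K, ‖x n m‖ ≤ D * C₁ * (n + 1 : ℝ) ^ (-(7 / 8) : ℝ) := by
    intro n K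
    calc ∑ m ∈ range K, ‖x n m‖
        ≤ ∑ m ∈ range K, D * (n + 1 : ℝ) ^ (-(7 / 8) : ℝ) * |(m : ℝ) - n| ^ (-(9 / 8) : ℝ) := by
          refine sum_le_sum fun m _ => ?_
          rw [hxq, norm_mul, Complex.norm_real, Real.norm_eq_abs, mul_assoc]
          exact mul_le_mul (haD m) (abs_inv_sq_sub_sq_le m n) (abs_nonneg _) hD0
      _ ≤ D * (n + 1 : ℝ) ^ (-(7 / 8) : ℝ) * C₁ := by
          rw [← mul_sum]; gcongr; exact hC₁ n K
      _ = _ := by ring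
  have hS' : ∀ n K, ∑ m ∈ range K, ‖x n m‖ ≤ D * C₁ := fun n K =>
    (hS n K).trans (mul_le_of_le_one_right (by positivity) (hN1 n))
  have hT : ∀ n K, ‖∑ m ∈ range K, x n m‖ ≤
      ‖A‖ * |∑ m ∈ range K, q n m| + B * (4 * C₂) * (n + 1 : ℝ) ^ (-(7 / 4) : ℝ) := by
    intro n K
    have e : ∑ m ∈ range K, x n m = A * ((∑ m ∈ range K, q n m : ℝ) : ℂ) +
        ∑ m ∈ range K, (a m - A) * (q n m : ℂ) := by
      push_cast
      rw [mul_sum, ← sum_add_distrib]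
      exact sum_congr rfl fun m _ => by rw [hxq]; ring
    rw [e]
    refine (norm_add_le _ _).trans (add_le_add ?_ ?_)
    · rw [norm_mul, Complex.norm_real, Real.norm_eq_abs]
    · refine (norm_sum_le _ _).trans ?_
      calc ∑ m ∈ range K, ‖(a m - A) * (q n m : ℂ)‖
          ≤ ∑ m ∈ range K, B * (2 * (n + 1 : ℝ) ^ (-(7 / 4) : ℝ)) *
            ((m + 1 : ℝ) ^ (-(5 / 4) : ℝ) + |(m : ℝ) - n| ^ (-(5 / 4) : ℝ)) := by
            refine sum_le_sum fun m _ => ?_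
            rw [norm_mul, Complex.norm_real, Real.norm_eq_abs, mul_assoc B]
            refine (mul_le_mul_of_nonneg_right (ha m) (abs_nonneg _)).trans ?_
            rw [mul_assoc B]
            exact mul_le_mul_of_nonneg_left (inv_mul_abs_inv_sq_sub_sq_le m n) hB
        _ ≤ B * (2 * (n + 1 : ℝ) ^ (-(7 / 4) : ℝ)) * (C₂ + C₂) := by
            rw [← mul_sum, sum_add_distrib]; gcongr
            · exact hC₃ K
            · exact hC₂ n K
        _ = _ := by ring
  set E := Real.exp (D * C₁)
  have hP : ∀ n K, ‖∏ m ∈ range K, (1 + x n m) - 1‖ ≤ ‖A‖ * |∑ m ∈ range K, q n m| +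
      (B * (4 * C₂) + (D * C₁) ^ 2 * E) * (n + 1 : ℝ) ^ (-(7 / 4) : ℝ) := by
    intro n K
    have h1 := norm_prod_one_add_sub_one_sub_sum_le (range K) (x n)
    have hS0 : 0 ≤ ∑ m ∈ range K, ‖x n m‖ := by positivity
    have h2 := exp_sub_one_sub_le hS0
    have h3 : (∑ m ∈ range K, ‖x n m‖) ^ 2 * Real.exp (∑ m ∈ range K, ‖x n m‖) ≤
        (D * C₁ * (n + 1 : ℝ) ^ (-(7 / 8) : ℝ)) ^ 2 * E := by
      gcongr
      · exact hS n K
      · exact Real.exp_le_exp.2 (hS' n K)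
    have h4 : ((n + 1 : ℝ) ^ (-(7 / 8) : ℝ)) ^ 2 = (n + 1 : ℝ) ^ (-(7 / 4) : ℝ) := by
      rw [← Real.rpow_natCast, ← Real.rpow_mul (by positivity)]; norm_num
    rw [mul_pow, h4] at h3
    have h5 := norm_add_le (∏ m ∈ range K, (1 + x n m) - 1 - ∑ m ∈ range K, x n m)
      (∑ m ∈ range K, x n m)
    rw [sub_add_cancel] at h5
    linarith [hT n K]
  refine ⟨max E (‖A‖ + (B * (4 * C₂) + (D * C₁) ^ 2 * E)), fun n K => ?_, fun n => ?_⟩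
  · refine le_trans ?_ (le_max_left _ _)
    calc ‖∏ m ∈ range K, (1 + x n m)‖ ≤ ∏ m ∈ range K, (1 + ‖x n m‖) := by
          rw [norm_prod]
          refine prod_le_prod (fun _ _ => norm_nonneg _) fun m _ => ?_
          simpa using norm_add_le 1 (x n m)
      _ ≤ Real.exp (∑ m ∈ range K, ‖x n m‖) := Real.prod_one_add_le_exp_sum _ fun _ => norm_nonneg _
      _ ≤ E := Real.exp_le_exp.2 (hS' n K)
  · have hsum : Summable fun m => ‖x n m‖ :=
      summable_of_sum_range_le (fun _ => norm_nonneg _) (hS' n)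
    have hlim := (multipliable_one_add_of_summable hsum).hasProd.tendsto_prod_nat
    refine ⟨_, hlim, ?_⟩
    have hq' := tendsto_sum_inv_sq_sub_sq n
    have := le_of_tendsto_of_tendsto (hlim.sub_const 1).norm
      ((hq'.abs.const_mul ‖A‖).add_const _) (Eventually.of_forall (hP n))
    refine this.trans ?_
    have h6 : |3 / (4 * (n + 1 : ℝ) ^ 2)| ≤ (n + 1 : ℝ) ^ (-(7 / 4) : ℝ) := by
      rw [abs_of_pos (by positivity)]
      refine le_trans ?_ (inv_sq_le_rpow n)
      rw [div_le_iff₀ (by positivity)]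
      have : (n + 1 : ℝ) ≠ 0 := by positivity
      field_simp; norm_num
    calc _ ≤ ‖A‖ * (n + 1 : ℝ) ^ (-(7 / 4) : ℝ) +
          (B * (4 * C₂) + (D * C₁) ^ 2 * E) * (n + 1 : ℝ) ^ (-(7 / 4) : ℝ) := by gcongr
      _ = (‖A‖ + (B * (4 * C₂) + (D * C₁) ^ 2 * E)) * (n + 1 : ℝ) ^ (-(7 / 4) : ℝ) := by ring
      _ ≤ _ := by gcongr; exact le_max_right _ _

/-! ### The partial fraction expansion of the infinite product -/

theorem summable_norm_inv_sq_sub (ζ : ℂ) : Summable fun n : ℕ => ‖(((n : ℂ) + 1) ^ 2 - ζ)⁻¹‖ := by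
  refine (summable_inv_add_one_sq.mul_left 2).of_norm_bounded_eventually_nat ?_
  have h2 : ∀ᶠ n : ℕ in atTop, 2 * ‖ζ‖ ≤ n := tendsto_natCast_atTop_atTop.eventually_ge_atTop _
  filter_upwards [h2] with n hn
  have h3 : ((n : ℝ) + 1) ^ 2 / 2 ≤ ‖((n : ℂ) + 1) ^ 2 - ζ‖ := by
    have h4 := norm_sub_norm_le (((n : ℂ) + 1) ^ 2) ζ
    have h5 : ‖((n : ℂ) + 1) ^ 2‖ = ((n : ℝ) + 1) ^ 2 := by
      rw [norm_pow, norm_natCast_add_one]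
    rw [h5] at h4
    nlinarith [Nat.cast_nonneg (α := ℝ) n]
  rw [norm_norm, norm_inv, ← div_eq_mul_inv, inv_eq_one_div,
    div_le_div_iff₀ (lt_of_lt_of_le (by positivity) h3) (by positivity)]
  linarith

/-- The partial fraction expansion of `(ζ - w) ∏ (1 + α m / (M² - ζ))`, where `M = m + 1`, with
`e n` close to `α n`. It is taken relative to `ζ = 0`: the plain expansion would have the terms
`N² e n / (N² - ζ)`, which need not tend to zero. It is the limit of the finite expansions by
dominated convergence, because the finite residues are bounded uniformly in `n` and in the number
of factors. -/
theorem exists_tendsto_prod_partial_fraction {α : ℕ → ℂ} {A : ℂ} {B : ℝ}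
    (hα : ∀ m, ‖α m - A‖ ≤ B * (m + 1 : ℝ)⁻¹) (w : ℂ) :
    ∃ (G₀ : ℂ) (e : ℕ → ℂ) (C : ℝ), (∀ n, ‖e n - α n‖ ≤ C * (n + 1 : ℝ) ^ (-(7 / 4) : ℝ)) ∧
      ∀ ζ : ℂ, (∀ n : ℕ, ((n : ℂ) + 1) ^ 2 ≠ ζ) →
        Tendsto (fun K => (ζ - w) * ∏ m ∈ range K, (1 + α m / (((m : ℂ) + 1) ^ 2 - ζ))) atTop
          (𝓝 (ζ + G₀ + ζ * ∑' n, e n / (((n : ℂ) + 1) ^ 2 - ζ))) := by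
  obtain ⟨C, hC, hP⟩ := exists_prod_bound hα
  choose P hPlim hP1 using hP
  have hB : 0 ≤ B := by simpa using (norm_nonneg _).trans (hα 0)
  have hC0 : 0 ≤ C := by simpa using (norm_nonneg _).trans (hC 0 0)
  set D := ‖A‖ + B
  have hαD : ∀ m, ‖α m‖ ≤ D := norm_le_of_norm_sub_le hα
  have hD0 : 0 ≤ D := by positivity
  have hs0 : ∀ n : ℕ, ((n : ℂ) + 1) ^ 2 ≠ 0 := fun n =>
    pow_ne_zero _ (Nat.cast_add_one_ne_zero n)
  have hw : ∀ n : ℕ, ‖w / ((n : ℂ) + 1) ^ 2‖ ≤ ‖w‖ * (n + 1 : ℝ) ^ (-(7 / 4) : ℝ) := fun n => by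
    rw [norm_div, norm_pow, norm_natCast_add_one, div_eq_mul_inv]
    gcongr
    exact inv_sq_le_rpow n
  have hN1 : ∀ n : ℕ, (n + 1 : ℝ) ^ (-(7 / 4) : ℝ) ≤ 1 := fun n =>
    Real.rpow_le_one_of_one_le_of_nonpos (by linarith [Nat.cast_nonneg (α := ℝ) n]) (by norm_num)
  have hw1 : ∀ n : ℕ, ‖1 - w / ((n : ℂ) + 1) ^ 2‖ ≤ 1 + ‖w‖ := fun n => by
    refine (norm_sub_le _ _).trans ?_
    rw [norm_one]
    linarith [hw n, mul_le_of_le_one_right (norm_nonneg w) (hN1 n)]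
  have hsum0 : Summable fun n : ℕ => ‖α n / (((n : ℂ) + 1) ^ 2 - 0)‖ := by
    refine ((summable_norm_inv_sq_sub 0).mul_left D).of_nonneg_of_le (fun _ => norm_nonneg _)
      fun n => ?_
    rw [div_eq_mul_inv, norm_mul]
    gcongr
    exact hαD n
  have hlim0 := (multipliable_one_add_of_summable hsum0).hasProd.tendsto_prod_nat
  set Q := ∏' n : ℕ, (1 + α n / (((n : ℂ) + 1) ^ 2 - 0))
  refine ⟨-w * Q, fun n => α n * P n * (1 - w / ((n : ℂ) + 1) ^ 2),
    D * C * (1 + ‖w‖) + D * ‖w‖, fun n => ?_, fun ζ hζ => ?_⟩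
  · have e1 : α n * P n * (1 - w / ((n : ℂ) + 1) ^ 2) - α n =
        α n * ((P n - 1) * (1 - w / ((n : ℂ) + 1) ^ 2)) - α n * (w / ((n : ℂ) + 1) ^ 2) := by ring
    rw [e1]
    refine (norm_sub_le _ _).trans ?_
    rw [norm_mul, norm_mul, norm_mul]
    calc _ ≤ D * (C * (n + 1 : ℝ) ^ (-(7 / 4) : ℝ) * (1 + ‖w‖)) +
          D * (‖w‖ * (n + 1 : ℝ) ^ (-(7 / 4) : ℝ)) := by
          gcongr
          · exact hαD n
          · exact hP1 n
          · exact hw1 n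
          · exact hαD n
          · exact hw n
      _ = _ := by ring
  · set s : ℕ → ℂ := fun n => ((n : ℂ) + 1) ^ 2 with hs
    set R : ℕ → ℕ → ℂ := fun K n => ∏ m ∈ range K, (1 + α m / (s m - s n)) with hR
    have hfin : ∀ K, (ζ - w) * ∏ m ∈ range K, (1 + α m / (s m - ζ)) =
        ζ + -w * ∏ m ∈ range K, (1 + α m / (s m - 0)) +
        ζ * ∑ n ∈ range K, α n * R K n * (1 - w / s n) / (s n - ζ) := by
      intro K
      rw [prod_one_add_div_eq_partial_fraction natCast_add_one_sq_injective K fun n _ => hζ n,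
        prod_one_add_div_eq_partial_fraction natCast_add_one_sq_injective K fun n _ => hs0 n]
      have : ∀ n ∈ range K, ζ * (α n * R K n * (1 - w / s n) / (s n - ζ)) =
          (ζ - w) * (α n * R K n / (s n - ζ)) + w * (α n * R K n / (s n - 0)) := by
        intro n _
        have h1 : s n - ζ ≠ 0 := sub_ne_zero.2 (hζ n)
        have h2 : s n ≠ 0 := hs0 n
        rw [sub_zero]
        field_simp
        ring
      rw [mul_sum, sum_congr rfl this, sum_add_distrib, ← mul_sum, ← mul_sum]
      ring
    have hT : Tendsto (fun K => ∑' n, if n ∈ range K then α n * R K n * (1 - w / s n) / (s n - ζ)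
        else 0) atTop (𝓝 (∑' n, α n * P n * (1 - w / s n) / (s n - ζ))) := by
      refine tendsto_tsum_of_dominated_convergence
        (bound := fun n => D * C * (1 + ‖w‖) * ‖(s n - ζ)⁻¹‖)
        ((summable_norm_inv_sq_sub ζ).mul_left _) (fun n => ?_) (Eventually.of_forall fun K n => ?_)
      · have h1 : Tendsto (fun K => α n * R K n * (1 - w / s n) / (s n - ζ)) atTop
            (𝓝 (α n * P n * (1 - w / s n) / (s n - ζ))) :=
          (((hPlim n).const_mul (α n)).mul_const _).div_const _
        refine h1.congr' ?_
        filter_upwards [eventually_gt_atTop n] with K hK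
        rw [if_pos (mem_range.2 hK)]
      · split_ifs
        · rw [div_eq_mul_inv, norm_mul, norm_mul, norm_mul]
          gcongr
          · exact hαD n
          · exact hC n K
          · exact hw1 n
        · rw [norm_zero]; positivity
    have hT' : ∀ K, (∑' n, if n ∈ range K then α n * R K n * (1 - w / s n) / (s n - ζ) else 0) =
        ∑ n ∈ range K, α n * R K n * (1 - w / s n) / (s n - ζ) := fun K => by
      rw [tsum_eq_sum (s := range K) fun n hn => if_neg hn]
      exact sum_congr rfl fun n hn => if_pos hn
    simp_rw [hT'] at hT
    refine Tendsto.congr (fun K => (hfin K).symm) ?_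
    exact ((hlim0.const_mul (-w)).const_add ζ).add (hT.const_mul ζ)

/-! ### The Fourier series of the cosine and its consequences -/

theorem integral_exp_I_mul_symm {k : ℂ} (hk : k ≠ 0) :
    ∫ t in (-Real.pi)..Real.pi, Complex.exp (Complex.I * k * t) =
      2 * Complex.sin (k * Real.pi) / k := by
  rw [integral_exp_mul_complex (mul_ne_zero Complex.I_ne_zero hk), Complex.sin]
  have h : Complex.I * k ≠ 0 := mul_ne_zero Complex.I_ne_zero hk
  rw [div_eq_div_iff h hk]
  push_cast
  rw [show Complex.I * k * -(Real.pi : ℂ) = -(k * Real.pi) * Complex.I by ring,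
    show Complex.I * k * (Real.pi : ℂ) = (k * Real.pi) * Complex.I by ring]
  linear_combination (-(k * (Complex.exp (-(k * Real.pi) * Complex.I) -
    Complex.exp (k * Real.pi * Complex.I)))) * Complex.I_sq

theorem integral_fourier_mul_cos {x : ℂ} (hx : ∀ n : ℤ, x ≠ n) (n : ℤ) :
    ∫ t in (-Real.pi)..Real.pi, Complex.exp (-(n * t * Complex.I)) * Complex.cos (x * t) =
      (-1) ^ n * Complex.sin (Real.pi * x) * (2 * x / (x ^ 2 - n ^ 2)) := by
  have h1 : x - n ≠ 0 := sub_ne_zero.2 (hx n)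
  have h2 : x + n ≠ 0 := fun h => hx (-n) (by push_cast; linear_combination h)
  have e : ∀ t : ℝ, Complex.exp (-(n * t * Complex.I)) * Complex.cos (x * t) =
      (1 / 2) * Complex.exp (Complex.I * (x - n) * t) +
        (1 / 2) * Complex.exp (Complex.I * (-(x + n)) * t) := by
    intro t
    rw [Complex.cos,
      show Complex.I * (x - n) * t = -(n * t * Complex.I) + x * t * Complex.I by ring,
      show Complex.I * (-(x + n)) * t = -(n * t * Complex.I) + -(x * t) * Complex.I by ring,
      Complex.exp_add, Complex.exp_add]
    ring
  simp_rw [e]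
  rw [intervalIntegral.integral_add (Continuous.intervalIntegrable (by fun_prop) _ _)
    (Continuous.intervalIntegrable (by fun_prop) _ _), intervalIntegral.integral_const_mul,
    intervalIntegral.integral_const_mul, integral_exp_I_mul_symm h1,
    integral_exp_I_mul_symm (neg_ne_zero.2 h2)]
  have s1 : Complex.sin ((x - n) * Real.pi) = (-1) ^ n * Complex.sin (Real.pi * x) := by
    rw [sub_mul, sub_eq_add_neg, ← neg_mul, ← Int.cast_neg, complex_sin_add_int_mul_pi, zpow_neg,
      ← inv_zpow, inv_neg, inv_one, mul_comm x]
  have s2 : Complex.sin (-(x + n) * Real.pi) = -((-1) ^ n * Complex.sin (Real.pi * x)) := by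
    rw [neg_mul, Complex.sin_neg, add_mul, complex_sin_add_int_mul_pi, mul_comm x]
  rw [s1, s2]
  have h3 : x ^ 2 - n ^ 2 ≠ 0 := by
    rw [sq_sub_sq]; exact mul_ne_zero h2 h1
  field_simp
  ring

theorem summable_div_sq_sub_int_sq (x : ℂ) :
    Summable fun n : ℤ => ‖(x ^ 2 - (n : ℂ) ^ 2)⁻¹‖ := by
  have h1 : Summable fun n : ℤ => 2 * (1 / ((n : ℝ)) ^ 2) :=
    (Real.summable_one_div_int_pow.2 one_lt_two).mul_left 2
  refine h1.of_norm_bounded_eventually ?_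
  have h2 : ∀ᶠ n : ℤ in cofinite, 2 * ‖x‖ ^ 2 + 1 ≤ (n : ℝ) ^ 2 := by
    have h3 : Tendsto (fun n : ℤ => ((n : ℝ)) ^ 2) cofinite atTop := by
      have := (tendsto_pow_atTop (α := ℝ) two_ne_zero).comp
        (tendsto_norm_cocompact_atTop.comp Int.tendsto_coe_cofinite)
      simpa [Function.comp_def] using! this
    exact h3.eventually_ge_atTop _
  filter_upwards [h2] with n hn
  have hn0 : 0 < (n : ℝ) ^ 2 := by nlinarith [sq_nonneg ‖x‖]
  have h3 : (n : ℝ) ^ 2 / 2 ≤ ‖x ^ 2 - (n : ℂ) ^ 2‖ := by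
    have h4 := norm_sub_norm_le ((n : ℂ) ^ 2) (x ^ 2)
    have h5 : ‖(n : ℂ) ^ 2‖ = (n : ℝ) ^ 2 := by
      rw [norm_pow, Complex.norm_intCast, sq_abs]
    rw [h5, norm_pow, norm_sub_rev] at h4
    linarith
  rw [norm_norm, norm_inv, inv_eq_one_div, ← mul_div_assoc, mul_one,
    div_le_div_iff₀ (lt_of_lt_of_le (by positivity) h3) hn0]
  linarith

/-- The Fourier series of `cos (x t)` on `(-π, π]`. The function has equal values at the end points,
so the series converges absolutely, up to and including `t = π`. -/
theorem hasSum_cos_int {x : ℂ} (hx : ∀ n : ℤ, x ≠ n) {t : ℝ} (ht : t ∈ Set.Ioc (-Real.pi) Real.pi) :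
    HasSum (fun n : ℤ => (-1) ^ n * Complex.sin (Real.pi * x) * x / (Real.pi * (x ^ 2 - n ^ 2)) *
      Complex.exp (n * t * Complex.I)) (Complex.cos (x * t)) := by
  have : Fact (0 < 2 * Real.pi) := ⟨Real.two_pi_pos⟩
  set f : ℝ → ℂ := fun t => Complex.cos (x * t) with hf
  have hfc : Continuous f := by fun_prop
  have hend : f (-Real.pi) = f (-Real.pi + 2 * Real.pi) := by
    simp only [hf]
    rw [show -Real.pi + 2 * Real.pi = Real.pi by ring]
    push_cast
    rw [mul_neg, Complex.cos_neg]
  let F : C(AddCircle (2 * Real.pi), ℂ) := ⟨AddCircle.liftIoc (2 * Real.pi) (-Real.pi) f,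
    AddCircle.liftIoc_continuous hend hfc.continuousOn⟩
  have hpi : (Real.pi : ℂ) ≠ 0 := by exact_mod_cast Real.pi_ne_zero
  have hcoef : ∀ n : ℤ, fourierCoeff F n =
      (-1) ^ n * Complex.sin (Real.pi * x) * x / (Real.pi * (x ^ 2 - n ^ 2)) := by
    intro n
    have h1 : fourierCoeff F n = _ := fourierCoeff_liftIoc_eq f n
    rw [h1, fourierCoeffOn_eq_integral]
    have h2 : ∫ t in (-Real.pi)..(-Real.pi + 2 * Real.pi),
        fourier (-n) (t : AddCircle (-Real.pi + 2 * Real.pi - -Real.pi)) • f t =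
        ∫ t in (-Real.pi)..Real.pi, Complex.exp (-(n * t * Complex.I)) * Complex.cos (x * t) := by
      rw [show -Real.pi + 2 * Real.pi = Real.pi by ring]
      refine intervalIntegral.integral_congr fun t _ => ?_
      simp only [fourier_coe_apply, smul_eq_mul, hf]
      congr 2
      push_cast
      field_simp
      ring
    rw [h2, integral_fourier_mul_cos hx, Complex.real_smul]
    push_cast
    have h3 : x ^ 2 - (n : ℂ) ^ 2 ≠ 0 := by
      rw [sq_sub_sq]
      exact mul_ne_zero (fun h => hx (-n) (by push_cast; linear_combination h))
        (sub_ne_zero.2 (hx n))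
    rw [show -(Real.pi : ℂ) + 2 * Real.pi - -Real.pi = 2 * Real.pi by ring]
    field_simp
  have hsum : Summable (fourierCoeff F) := by
    have : fourierCoeff F = fun n : ℤ =>
        (-1) ^ n * Complex.sin (Real.pi * x) * x / (Real.pi * (x ^ 2 - n ^ 2)) :=
      funext hcoef
    rw [this]
    refine ((summable_div_sq_sub_int_sq x).mul_left
      ‖Complex.sin (Real.pi * x) * x / Real.pi‖).of_norm_bounded fun n => ?_
    rw [← norm_mul, show (-1 : ℂ) ^ n * Complex.sin (Real.pi * x) * x / (Real.pi * (x ^ 2 - n ^ 2))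
      = (-1) ^ n * (Complex.sin (Real.pi * x) * x / Real.pi * (x ^ 2 - (n : ℂ) ^ 2)⁻¹) by
        rw [← div_div, div_eq_mul_inv _ (x ^ 2 - (n : ℂ) ^ 2)]; ring, norm_mul]
    simp
  have h := has_pointwise_sum_fourier_series_of_summable hsum (t : AddCircle (2 * Real.pi))
  have hFt : AddCircle.liftIoc (2 * Real.pi) (-Real.pi) f (t : AddCircle (2 * Real.pi)) = f t :=
    AddCircle.liftIoc_coe_apply (by rwa [show -Real.pi + 2 * Real.pi = Real.pi by ring])
  have hFt' : F (t : AddCircle (2 * Real.pi)) = Complex.cos (x * t) := hFt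
  rw [hFt'] at h
  refine h.congr_fun fun n => ?_
  rw [hcoef, smul_eq_mul, fourier_coe_apply]
  congr 2
  push_cast
  field_simp

/-- The Fourier series of `cos (x t)` with the terms of index `± (k + 1)` combined and the constant
term moved to the other side. -/
theorem hasSum_cos_nat {x : ℂ} (hx : ∀ n : ℤ, x ≠ n) {t : ℝ} (ht : t ∈ Set.Ioc (-Real.pi) Real.pi) :
    HasSum (fun k : ℕ => -(2 * x * Complex.sin (Real.pi * x) / Real.pi) *
      ((-1) ^ (k + 1) * (Complex.cos ((k + 1) * t) / ((k + 1) ^ 2 - x ^ 2))))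
      (Complex.cos (x * t) - Complex.sin (Real.pi * x) / (Real.pi * x)) := by
  have h := (hasSum_cos_int hx ht).nat_add_neg
  rw [← hasSum_nat_add_iff' 1] at h
  have hx0 : x ≠ 0 := by simpa using hx 0
  have hpi : (Real.pi : ℂ) ≠ 0 := by exact_mod_cast Real.pi_ne_zero
  have e : Complex.cos (x * t) + (-1) ^ (0 : ℤ) * Complex.sin (Real.pi * x) * x /
      (Real.pi * (x ^ 2 - (0 : ℤ) ^ 2)) * Complex.exp ((0 : ℤ) * t * Complex.I) -
      ∑ i ∈ range 1, ((-1) ^ (i : ℤ) * Complex.sin (Real.pi * x) * x /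
      (Real.pi * (x ^ 2 - (i : ℤ) ^ 2)) * Complex.exp ((i : ℤ) * t * Complex.I) +
      (-1) ^ (-(i : ℤ)) * Complex.sin (Real.pi * x) * x /
      (Real.pi * (x ^ 2 - (-(i : ℤ) : ℤ) ^ 2)) * Complex.exp ((-(i : ℤ) : ℤ) * t * Complex.I)) =
      Complex.cos (x * t) - Complex.sin (Real.pi * x) / (Real.pi * x) := by
    simp
    field_simp
  rw [e] at h
  refine h.congr_fun fun k => ?_
  have h1 : (-1 : ℂ) ^ (-((k + 1 : ℕ) : ℤ)) = (-1) ^ (k + 1) := by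
    rw [zpow_neg, ← inv_zpow, inv_neg, inv_one, zpow_natCast]
  have h3 := sub_ne_zero.2 (sq_natCast_add_one_ne_sq hx k)
  have h2 := sub_ne_zero.2 (sq_natCast_add_one_ne_sq hx k).symm
  rw [h1, zpow_natCast, Complex.cos]
  push_cast
  rw [neg_sq,
    show -((k : ℂ) + 1) * t * Complex.I = -(((k : ℂ) + 1) * t) * Complex.I by ring,
    ← neg_sub (x ^ 2)]
  field_simp

/-- The expansion of the cotangent, which is the Fourier series of `cos (x t)` at `t = π`. -/
theorem hasSum_inv_sq_sub_sq {x : ℂ} (hx : Complex.sin (Real.pi * x) ≠ 0) :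
    HasSum (fun k : ℕ => (((k : ℂ) + 1) ^ 2 - x ^ 2)⁻¹)
      (1 / (2 * x ^ 2) - Real.pi * Complex.cos (Real.pi * x) /
        (2 * x * Complex.sin (Real.pi * x))) := by
  have hx' := sin_pi_mul_ne_zero_iff.1 hx
  have hx0 : x ≠ 0 := by simpa using hx' 0
  have hpi : (Real.pi : ℂ) ≠ 0 := by exact_mod_cast Real.pi_ne_zero
  have h := hasSum_cos_nat hx' (t := Real.pi) ⟨by linarith [Real.pi_pos], le_rfl⟩
  have h' := h.mul_left (-(Real.pi / (2 * x * Complex.sin (Real.pi * x))))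
  have e : -(Real.pi / (2 * x * Complex.sin (Real.pi * x))) *
      (Complex.cos (x * Real.pi) - Complex.sin (Real.pi * x) / (Real.pi * x)) =
      1 / (2 * x ^ 2) - Real.pi * Complex.cos (Real.pi * x) /
        (2 * x * Complex.sin (Real.pi * x)) := by
    rw [mul_comm x]; field_simp; ring
  rw [e] at h'
  refine h'.congr_fun fun k => ?_
  have h1 : Complex.cos (((k : ℂ) + 1) * Real.pi) = (-1) ^ (k + 1) := by
    exact_mod_cast complex_cos_nat_mul_pi (k + 1)
  have h2 : (-1 : ℂ) ^ (k + 1) * (-1) ^ (k + 1) = 1 := by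
    rw [← mul_pow]; simp
  rw [h1, ← mul_div_assoc, h2]
  generalize Complex.sin (Real.pi * x) = S at hx
  field_simp

/-- The expansion of `sin (π x / 2) / sin (π x)`, obtained by integrating the Fourier series of
`cos (x t)` over `[0, π / 2]`. -/
theorem hasSum_sin_half_div {x : ℂ} (hx : Complex.sin (Real.pi * x) ≠ 0) :
    HasSum (fun k : ℕ => Complex.sin (((k : ℂ) + 1) * (Real.pi / 2)) / ((k : ℂ) + 1) *
        (((k : ℂ) + 1) ^ 2 - x ^ 2)⁻¹)
      (Real.pi * Complex.sin (x * (Real.pi / 2)) / (2 * x ^ 2 * Complex.sin (Real.pi * x))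
        - Real.pi / (4 * x ^ 2)) := by
  have hx' := sin_pi_mul_ne_zero_iff.1 hx
  have hx0 : x ≠ 0 := by simpa using hx' 0
  have hpi : (Real.pi : ℂ) ≠ 0 := by exact_mod_cast Real.pi_ne_zero
  have hpos := Real.pi_pos
  have hbound : Summable fun k : ℕ => ‖2 * x * Complex.sin (Real.pi * x) / Real.pi‖ *
      ‖(((k : ℂ) + 1) ^ 2 - x ^ 2)⁻¹‖ := (summable_norm_inv_sq_sub (x ^ 2)).mul_left _
  have h := intervalIntegral.hasSum_integral_of_dominated_convergence (μ := volume)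
    (a := 0) (b := Real.pi / 2)
    (F := fun (k : ℕ) t => -(2 * x * Complex.sin (Real.pi * x) / Real.pi) *
      ((-1) ^ (k + 1) * (Complex.cos ((k + 1) * t) / ((k + 1) ^ 2 - x ^ 2))))
    (f := fun t => Complex.cos (x * t) - Complex.sin (Real.pi * x) / (Real.pi * x))
    (fun k _ => ‖2 * x * Complex.sin (Real.pi * x) / Real.pi‖ *
      ‖(((k : ℂ) + 1) ^ 2 - x ^ 2)⁻¹‖)
    (fun k => (Continuous.aestronglyMeasurable (by fun_prop)))
    (fun k => ae_of_all _ fun t _ => by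
      have h1 : ‖Complex.cos (((k : ℂ) + 1) * t)‖ ≤ 1 := by
        have : (((k : ℂ) + 1) * t) = (((k + 1) * t : ℝ) : ℂ) := by push_cast; ring
        rw [this, ← Complex.ofReal_cos, Complex.norm_real]
        exact Real.abs_cos_le_one _
      rw [norm_mul, norm_neg, norm_mul, norm_pow, norm_neg, norm_one, one_pow, one_mul,
        div_eq_mul_inv (Complex.cos _), norm_mul (Complex.cos _)]
      gcongr
      exact mul_le_of_le_one_left (norm_nonneg _) h1)
    (ae_of_all _ fun _ _ => hbound) intervalIntegrable_const
    (ae_of_all _ fun t ht => hasSum_cos_nat hx' (by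
      rw [Set.uIoc_of_le (by positivity)] at ht
      exact ⟨by linarith [ht.1], by linarith [ht.2]⟩))
  have h' := h.mul_left (Real.pi / (2 * x * Complex.sin (Real.pi * x)))
  have hcos : ∀ {c : ℂ}, c ≠ 0 → ∫ t in (0 : ℝ)..(Real.pi / 2), Complex.cos (c * t) =
      Complex.sin (c * (Real.pi / 2)) / c := by
    intro c hc
    rw [integral_cos_mul_complex hc]
    simp
  have e : Real.pi / (2 * x * Complex.sin (Real.pi * x)) *
      (∫ t in (0 : ℝ)..(Real.pi / 2),
        (Complex.cos (x * t) - Complex.sin (Real.pi * x) / (Real.pi * x))) =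
      Real.pi * Complex.sin (x * (Real.pi / 2)) / (2 * x ^ 2 * Complex.sin (Real.pi * x))
        - Real.pi / (4 * x ^ 2) := by
    rw [intervalIntegral.integral_sub (Continuous.intervalIntegrable (by fun_prop) _ _)
      intervalIntegrable_const, hcos hx0, intervalIntegral.integral_const, Complex.real_smul]
    push_cast
    field_simp
    ring
  rw [e] at h'
  refine h'.congr_fun fun k => ?_
  have hk : (k : ℂ) + 1 ≠ 0 := Nat.cast_add_one_ne_zero k
  have h1 : ∫ t in (0 : ℝ)..(Real.pi / 2), -(2 * x * Complex.sin (Real.pi * x) / Real.pi) *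
      ((-1) ^ (k + 1) * (Complex.cos ((k + 1) * t) / ((k + 1) ^ 2 - x ^ 2))) =
      -(2 * x * Complex.sin (Real.pi * x) / Real.pi) *
      ((-1) ^ (k + 1) * (Complex.sin (((k : ℂ) + 1) * (Real.pi / 2)) / ((k : ℂ) + 1) /
        ((k + 1) ^ 2 - x ^ 2))) := by
    rw [intervalIntegral.integral_const_mul, intervalIntegral.integral_const_mul,
      intervalIntegral.integral_div, hcos hk]
  -- The sine vanishes for even `k + 1`.
  have h2 : (-1 : ℂ) ^ (k + 1) * Complex.sin (((k : ℂ) + 1) * (Real.pi / 2)) =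
      -Complex.sin (((k : ℂ) + 1) * (Real.pi / 2)) := by
    rcases Nat.even_or_odd (k + 1) with hk | hk
    · have : Complex.sin (((k : ℂ) + 1) * (Real.pi / 2)) = 0 := by
        obtain ⟨r, hr⟩ := hk
        have hr' : (k : ℂ) + 1 = r + r := by exact_mod_cast hr
        rw [hr', show ((r : ℂ) + r) * (Real.pi / 2) = r * Real.pi by ring, Complex.sin_nat_mul_pi]
      rw [this]; simp
    · rw [hk.neg_one_pow]; ring
  rw [h1]
  have h3 : -(2 * x * Complex.sin (Real.pi * x) / Real.pi) *
      ((-1) ^ (k + 1) * (Complex.sin (((k : ℂ) + 1) * (Real.pi / 2)) / ((k : ℂ) + 1) /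
        ((k + 1) ^ 2 - x ^ 2))) = -(2 * x * Complex.sin (Real.pi * x) / Real.pi) *
      ((-1) ^ (k + 1) * Complex.sin (((k : ℂ) + 1) * (Real.pi / 2)) / ((k : ℂ) + 1) /
        ((k + 1) ^ 2 - x ^ 2)) := by ring
  rw [h3, h2]
  generalize Complex.sin (Real.pi * x) = S at hx
  field_simp

/-! ### Sine series in `L²` and the kernel `sin (ρ t) / ρ` -/

theorem integral_sin_mul_sin {ν ρ : ℂ} (h : ρ ^ 2 ≠ ν ^ 2) (L : ℝ) :
    ∫ t in (0 : ℝ)..L, Complex.sin (ν * t) * Complex.sin (ρ * t) =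
      (ν * Complex.cos (ν * L) * Complex.sin (ρ * L)
        - ρ * Complex.sin (ν * L) * Complex.cos (ρ * L)) / (ρ ^ 2 - ν ^ 2) := by
  have h' : ρ ^ 2 - ν ^ 2 ≠ 0 := sub_ne_zero.2 h
  have key : ∀ t ∈ Set.uIcc 0 L, HasDerivAt (fun t : ℝ =>
      (ν * Complex.cos (ν * t) * Complex.sin (ρ * t)
        - ρ * Complex.sin (ν * t) * Complex.cos (ρ * t)) / (ρ ^ 2 - ν ^ 2))
      (Complex.sin (ν * t) * Complex.sin (ρ * t)) t := by
    intro t _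
    have hlin : ∀ c : ℂ, HasDerivAt (fun z : ℂ => c * z) c t := fun c => by
      simpa using (hasDerivAt_id (t : ℂ)).const_mul c
    have h1 := (((hlin ν).ccos.const_mul ν).mul (hlin ρ).csin).sub
      (((hlin ν).csin.const_mul ρ).mul (hlin ρ).ccos)
    convert! (h1.div_const (ρ ^ 2 - ν ^ 2)).comp_ofReal using 1
    field_simp
    ring
  rw [intervalIntegral.integral_eq_sub_of_hasDerivAt key
    (Continuous.intervalIntegrable (by fun_prop) _ _)]
  simp

theorem integral_sin_node_mul_sin {L : ℝ} (hL : 0 < L) (k : ℕ) {ρ : ℂ}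
    (h : ρ ^ 2 ≠ (Real.pi * (k + 1) / L) ^ 2) :
    ∫ t in (0 : ℝ)..L, Complex.sin (Real.pi * (k + 1) / L * t) * Complex.sin (ρ * t) =
      (-1) ^ (k + 1) * (Real.pi * (k + 1) / L) * Complex.sin (ρ * L)
        / (ρ ^ 2 - (Real.pi * (k + 1) / L) ^ 2) := by
  have hL' : (L : ℂ) ≠ 0 := by exact_mod_cast hL.ne'
  have e : (Real.pi * (k + 1) / L : ℂ) * L = (k + 1 : ℕ) * Real.pi := by
    push_cast; field_simp
  rw [integral_sin_mul_sin h, e, Complex.sin_nat_mul_pi,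
    complex_cos_nat_mul_pi]
  ring

theorem integral_sin_node_sq {L : ℝ} (hL : 0 < L) (k : ℕ) :
    ∫ t in (0 : ℝ)..L, Complex.sin (Real.pi * (k + 1) / L * t) *
      Complex.sin (Real.pi * (k + 1) / L * t) = L / 2 := by
  have hL' : (L : ℂ) ≠ 0 := by exact_mod_cast hL.ne'
  have hpi : (Real.pi : ℂ) ≠ 0 := by exact_mod_cast Real.pi_ne_zero
  have hk : (k : ℂ) + 1 ≠ 0 := Nat.cast_add_one_ne_zero k
  set ν : ℂ := Real.pi * (k + 1) / L with hν
  have hν0 : ν ≠ 0 := by rw [hν]; positivity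
  have e : ∀ t : ℝ, Complex.sin (ν * t) * Complex.sin (ν * t) =
      1 / 2 - Complex.cos (2 * ν * t) / 2 := by
    intro t
    rw [mul_assoc, Complex.cos_two_mul, Complex.cos_sq']
    ring
  simp_rw [e]
  rw [intervalIntegral.integral_sub intervalIntegrable_const
    (Continuous.intervalIntegrable (by fun_prop) _ _), intervalIntegral.integral_div,
    intervalIntegral.integral_div,
    integral_cos_mul_complex (mul_ne_zero two_ne_zero hν0), intervalIntegral.integral_const]
  have e2 : 2 * ν * L = (2 * (k + 1) : ℕ) * Real.pi := by
    rw [hν]; push_cast; field_simp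
  rw [e2, Complex.sin_nat_mul_pi]
  simp

/-- A square-summable sequence `w` is the sequence of sine coefficients of some `W ∈ L²(0, L)`, and
the pairing of `W` with `sin (ρ t)` can be computed term by term. Only the orthogonality of the
sines is used, not their completeness. -/
theorem exists_memLp_hasSum_sine {L : ℝ} (hL : 0 < L) {w : ℕ → ℂ} (hw : Memℓp w 2) :
    ∃ W : ℝ → ℂ, MemLp W 2 (volume.restrict (Set.Ioo 0 L)) ∧ ∀ ρ : ℂ,
      HasSum (fun k : ℕ => w k *
        ∫ t in (0 : ℝ)..L, Complex.sin (Real.pi * (k + 1) / L * t) * Complex.sin (ρ * t))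
        (∫ t in (0 : ℝ)..L, W t * Complex.sin (ρ * t)) := by
  set μ := volume.restrict (Set.Ioo 0 L) with hμ
  have hmem : ∀ {f : ℝ → ℂ}, Continuous f → MemLp f 2 μ := fun {f} hf => by
    obtain ⟨C, hC⟩ := isCompact_Icc.exists_bound_of_continuousOn (s := Set.Icc 0 L) hf.continuousOn
    refine MemLp.of_bound hf.aestronglyMeasurable C ?_
    filter_upwards [ae_restrict_mem measurableSet_Ioo] with t ht
    exact hC t (Set.Ioo_subset_Icc_self ht)
  have hint : ∀ f : ℝ → ℂ, ∫ t in (0 : ℝ)..L, f t = ∫ t, f t ∂μ := fun f => by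
    rw [intervalIntegral.integral_of_le hL.le, integral_Ioc_eq_integral_Ioo]
  set c : ℝ := √(2 / L) with hc
  have hc0 : (c : ℂ) ≠ 0 := by
    have : 0 < c := Real.sqrt_pos.2 (by positivity)
    exact_mod_cast this.ne'
  have hcc : (c : ℂ) * c = 2 / L := by
    rw [← Complex.ofReal_mul, Real.mul_self_sqrt (by positivity)]; push_cast; rfl
  have hcont : ∀ k : ℕ, Continuous fun t : ℝ => (c : ℂ) * Complex.sin (Real.pi * (k + 1) / L * t) :=
    fun k => by fun_prop
  set v : ℕ → Lp ℂ 2 μ := fun k => (hmem (hcont k)).toLp _ with hv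
  have hconj : ∀ (k : ℕ) (t : ℝ), (starRingEnd ℂ) (c * Complex.sin (Real.pi * (k + 1) / L * t)) =
      c * Complex.sin (Real.pi * (k + 1) / L * t) := fun k t => by
    have : (c * Complex.sin (Real.pi * (k + 1) / L * t) : ℂ) =
        ((c * Real.sin (Real.pi * (k + 1) / L * t) : ℝ) : ℂ) := by push_cast; rfl
    rw [this, Complex.conj_ofReal]
  have hinner : ∀ {f g : ℝ → ℂ} (hf : MemLp f 2 μ) (hg : MemLp g 2 μ),
      inner ℂ (hf.toLp f) (hg.toLp g) = ∫ t in (0 : ℝ)..L, g t * (starRingEnd ℂ) (f t) := by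
    intro f g hf hg
    rw [hint, L2.inner_def]
    refine integral_congr_ae ?_
    filter_upwards [hf.coeFn_toLp, hg.coeFn_toLp] with t h1 h2
    rw [h1, h2, RCLike.inner_apply]
  have hL' : (L : ℂ) ≠ 0 := by exact_mod_cast hL.ne'
  have hpi : (Real.pi : ℂ) ≠ 0 := by exact_mod_cast Real.pi_ne_zero
  have hon : Orthonormal ℂ v := by
    rw [orthonormal_iff_ite]
    intro i j
    rw [hinner]
    simp_rw [hconj]
    have e : ∀ t : ℝ, (c : ℂ) * Complex.sin (Real.pi * (j + 1) / L * t) *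
        (c * Complex.sin (Real.pi * (i + 1) / L * t)) = 2 / L *
        (Complex.sin (Real.pi * (j + 1) / L * t) * Complex.sin (Real.pi * (i + 1) / L * t)) := by
      intro t; rw [← hcc]; ring
    simp_rw [e]
    rw [intervalIntegral.integral_const_mul]
    split_ifs with hij
    · subst hij
      rw [integral_sin_node_sq hL]
      field_simp
    · rw [integral_sin_node_mul_sin hL]
      · have e2 : (Real.pi * (i + 1) / L : ℂ) * L = (i + 1 : ℕ) * Real.pi := by
          push_cast; field_simp
        rw [e2, Complex.sin_nat_mul_pi]
        simp
      · intro h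
        rw [mul_div_right_comm, mul_div_right_comm, mul_pow, mul_pow] at h
        have h' := mul_left_cancel₀ (pow_ne_zero 2 (div_ne_zero hpi hL')) h
        exact hij (natCast_add_one_sq_injective h')
  set w' : lp (fun _ : ℕ => ℂ) 2 := ⟨(c : ℂ)⁻¹ • w, hw.const_smul _⟩ with hw'
  have hsum := hon.orthogonalFamily.hasSum_linearIsometry w'
  set WL := hon.orthogonalFamily.linearIsometry w'
  refine ⟨WL, Lp.memLp WL, fun ρ => ?_⟩
  have hS : MemLp (fun t : ℝ => (starRingEnd ℂ) (Complex.sin (ρ * t))) 2 μ :=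
    hmem (Complex.continuous_conj.comp (by fun_prop))
  have h := hsum.mapL (innerSL ℂ (hS.toLp _))
  have e1 : innerSL ℂ (hS.toLp _) WL = ∫ t in (0 : ℝ)..L, WL t * Complex.sin (ρ * t) := by
    rw [innerSL_apply_apply, hint, L2.inner_def]
    refine integral_congr_ae ?_
    filter_upwards [hS.coeFn_toLp] with t h1
    rw [h1, RCLike.inner_apply, Complex.conj_conj]
  rw [e1] at h
  refine h.congr_fun fun k => ?_
  rw [innerSL_apply_apply, LinearIsometry.toSpanSingleton_apply, inner_smul_right, hinner]
  simp_rw [Complex.conj_conj]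
  have e3 : ∀ t : ℝ, (c : ℂ) * Complex.sin (Real.pi * (k + 1) / L * t) * Complex.sin (ρ * t) =
    c * (Complex.sin (Real.pi * (k + 1) / L * t) * Complex.sin (ρ * t)) := fun t => mul_assoc _ _ _
  simp_rw [e3]
  rw [intervalIntegral.integral_const_mul, hw']
  simp only [Pi.smul_apply, smul_eq_mul]
  generalize ∫ t in (0 : ℝ)..L, Complex.sin (Real.pi * (k + 1) / L * t) * Complex.sin (ρ * t) = J
  field_simp

theorem norm_sin_le_mul_exp (z : ℂ) : ‖Complex.sin z‖ ≤ ‖z‖ * Real.exp ‖z‖ := by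
  have h : ∀ z : ℂ, ‖Complex.exp z - 1‖ ≤ ‖z‖ * Real.exp ‖z‖ := fun z => by
    simpa using Complex.norm_exp_sub_sum_le_norm_mul_exp z 1
  have h1 := h (-z * Complex.I)
  have h2 := h (z * Complex.I)
  rw [norm_mul, norm_neg, Complex.norm_I, mul_one] at h1
  rw [norm_mul, Complex.norm_I, mul_one] at h2
  have e : Complex.sin z = ((Complex.exp (-z * Complex.I) - 1) - (Complex.exp (z * Complex.I) - 1))
      * Complex.I / 2 := by rw [Complex.sin]; ring
  rw [e, norm_div, norm_mul, Complex.norm_I, mul_one, Complex.norm_two]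
  linarith [norm_sub_le (Complex.exp (-z * Complex.I) - 1) (Complex.exp (z * Complex.I) - 1)]

theorem norm_sinQuot_le {t : ℝ} (ht : 0 ≤ t) (ρ : ℂ) : ‖sinQuot t ρ‖ ≤ t * Real.exp (‖ρ‖ * t) := by
  rw [sinQuot]
  split_ifs with h
  · subst h
    simp [abs_of_nonneg ht]
  · have h0 : 0 < ‖ρ‖ := norm_pos_iff.2 h
    have := norm_sin_le_mul_exp (ρ * t)
    rw [norm_mul, Complex.norm_real, Real.norm_eq_abs, abs_of_nonneg ht] at this
    rw [norm_div, div_le_iff₀ h0]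
    linarith

theorem continuous_sinQuot (t : ℝ) : Continuous (sinQuot t) := by
  have hd : HasDerivAt (fun ρ : ℂ => Complex.sin (ρ * t)) t 0 := by
    have h1 : HasDerivAt (fun ρ : ℂ => ρ * (t : ℂ)) t 0 := by
      simpa using (hasDerivAt_id (0 : ℂ)).mul_const (t : ℂ)
    simpa using h1.csin
  have e : sinQuot t = dslope (fun ρ : ℂ => Complex.sin (ρ * t)) 0 := by
    funext ρ
    rw [sinQuot]
    split_ifs with h
    · rw [h, dslope_same, hd.deriv]
    · rw [dslope_of_ne _ h, slope_def_field]
      simp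
  rw [e, continuous_iff_continuousAt]
  intro ρ
  rcases eq_or_ne ρ 0 with rfl | h
  · exact continuousAt_dslope_same.2 hd.differentiableAt
  · rw [continuousAt_dslope_of_ne h]
    fun_prop

theorem continuous_sinQuot_left (ρ : ℂ) : Continuous fun t => sinQuot t ρ := by
  unfold sinQuot
  split_ifs <;> fun_prop

theorem continuous_integral_mul_sinQuot {L : ℝ} (hL : 0 < L) {W : ℝ → ℂ}
    (hW : MemLp W 2 (volume.restrict (Set.Ioo 0 L))) :
    Continuous fun ρ : ℂ => ∫ t in (0 : ℝ)..L, W t * (sinQuot t ρ / 2) := by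
  have hW1 : Integrable W (volume.restrict (Set.Ioc 0 L)) := by
    rw [← restrict_Ioo_eq_restrict_Ioc]
    exact hW.integrable one_le_two
  rw [continuous_iff_continuousAt]
  intro ρ₀
  refine intervalIntegral.continuousAt_of_dominated_interval
    (bound := fun t => ‖W t‖ * (L * Real.exp ((‖ρ₀‖ + 1) * L))) ?_ ?_ ?_ ?_
  · refine Eventually.of_forall fun ρ => ?_
    rw [Set.uIoc_of_le hL.le]
    exact hW1.aestronglyMeasurable.mul
      ((continuous_sinQuot_left ρ).div_const 2).aestronglyMeasurable
  · have hball : ∀ᶠ ρ in 𝓝 ρ₀, ‖ρ‖ < ‖ρ₀‖ + 1 :=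
      continuous_norm.continuousAt.eventually_lt continuousAt_const (lt_add_one _)
    filter_upwards [hball] with ρ hρ
    refine ae_of_all _ fun t ht => ?_
    rw [Set.uIoc_of_le hL.le] at ht
    rw [norm_mul, norm_div, Complex.norm_two]
    have h1 := norm_sinQuot_le ht.1.le ρ
    have h2 : t * Real.exp (‖ρ‖ * t) ≤ L * Real.exp ((‖ρ₀‖ + 1) * L) := by
      gcongr
      · exact ht.2
      · exact ht.1.le
      · exact ht.2
    gcongr
    linarith [norm_nonneg (sinQuot t ρ)]
  · rw [intervalIntegrable_iff_integrableOn_Ioc_of_le hL.le]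
    exact hW1.norm.mul_const _
  · exact ae_of_all _ fun t _ =>
      (continuousAt_const.mul ((continuous_sinQuot t).continuousAt.div_const 2))

/-! ### Convergence of the product, and the spectral asymptotics -/

theorem prodFactor_eq {l : ℝ} (hl : 0 < l) (lam : ℕ → ℂ) (z : ℂ) (k : ℕ) :
    prodFactor l lam z k = 1 + (lam (k + 1) - (Real.pi / (2 * l) : ℂ) ^ 2 * ((k : ℂ) + 1) ^ 2 - z) /
      ((Real.pi / (2 * l) : ℂ) ^ 2 * ((k : ℂ) + 1) ^ 2) := by
  have hl' : (l : ℂ) ≠ 0 := by exact_mod_cast hl.ne'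
  have hpi : (Real.pi : ℂ) ≠ 0 := by exact_mod_cast Real.pi_ne_zero
  have hk : (k : ℂ) + 1 ≠ 0 := Nat.cast_add_one_ne_zero k
  rw [prodFactor]
  push_cast
  field_simp
  ring

section Convergence

variable {l : ℝ} {lam : ℕ → ℂ} {M : ℝ}

theorem norm_factor_sub_one_le (hl : 0 < l)
    (hM : ∀ k : ℕ, ‖lam (k + 1) - (Real.pi / (2 * l) : ℂ) ^ 2 * ((k : ℂ) + 1) ^ 2‖ ≤ M)
    {r : ℝ} {z : ℂ} (hz : ‖z‖ ≤ r) (k : ℕ) :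
    ‖(lam (k + 1) - (Real.pi / (2 * l) : ℂ) ^ 2 * ((k : ℂ) + 1) ^ 2 - z) /
      ((Real.pi / (2 * l) : ℂ) ^ 2 * ((k : ℂ) + 1) ^ 2)‖ ≤
      (M + r) / (Real.pi / (2 * l)) ^ 2 * (((k : ℝ) + 1) ^ 2)⁻¹ := by
  have hpos := Real.pi_pos
  have e : ‖(Real.pi / (2 * l) : ℂ) ^ 2 * ((k : ℂ) + 1) ^ 2‖ =
      (Real.pi / (2 * l)) ^ 2 * ((k : ℝ) + 1) ^ 2 := by
    have : (Real.pi / (2 * l) : ℂ) ^ 2 * ((k : ℂ) + 1) ^ 2 =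
        (((Real.pi / (2 * l)) ^ 2 * ((k : ℝ) + 1) ^ 2 : ℝ) : ℂ) := by push_cast; rfl
    rw [this, Complex.norm_real, Real.norm_eq_abs, abs_of_nonneg (by positivity)]
  rw [norm_div, e, div_mul_eq_div_div, div_eq_mul_inv _ (((k : ℝ) + 1) ^ 2)]
  gcongr
  exact (norm_sub_le _ _).trans (add_le_add (hM k) hz)

theorem multipliable_prodFactor (hl : 0 < l)
    (hM : ∀ k : ℕ, ‖lam (k + 1) - (Real.pi / (2 * l) : ℂ) ^ 2 * ((k : ℂ) + 1) ^ 2‖ ≤ M) (z : ℂ) :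
    Multipliable (prodFactor l lam z) := by
  rw [funext (prodFactor_eq hl lam z)]
  exact multipliable_one_add_of_summable ((summable_inv_add_one_sq.mul_left _).of_nonneg_of_le
    (fun _ => norm_nonneg _) (norm_factor_sub_one_le hl hM le_rfl))

theorem continuous_tprod_prodFactor (hl : 0 < l)
    (hM : ∀ k : ℕ, ‖lam (k + 1) - (Real.pi / (2 * l) : ℂ) ^ 2 * ((k : ℂ) + 1) ^ 2‖ ≤ M) :
    Continuous fun z => ∏' k, prodFactor l lam z k := by
  simp_rw [prodFactor_eq hl]
  rw [continuous_iff_continuousAt]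
  intro z₀
  have hcont : ∀ k : ℕ, Continuous fun z =>
      (lam (k + 1) - (Real.pi / (2 * l) : ℂ) ^ 2 * ((k : ℂ) + 1) ^ 2 - z) /
      ((Real.pi / (2 * l) : ℂ) ^ 2 * ((k : ℂ) + 1) ^ 2) := fun k => by fun_prop
  have h := Summable.hasProdUniformlyOn_nat_one_add (isCompact_closedBall (0 : ℂ) (‖z₀‖ + 1))
    (summable_inv_add_one_sq.mul_left _)
    (Eventually.of_forall fun k z hz =>
      norm_factor_sub_one_le hl hM (mem_closedBall_zero_iff.1 hz) k)
    fun k => (hcont k).continuousOn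
  have hc := h.tendstoUniformlyOn_finsetRange.continuousOn (Frequently.of_forall fun n =>
    continuousOn_finsetProd _ fun k _ => (continuous_const.add (hcont k)).continuousOn)
  refine hc.continuousAt (Metric.closedBall_mem_nhds_of_mem ?_)
  rw [mem_ball_zero_iff]
  exact lt_add_one _

theorem continuous_prodDelta (d : ℝ) (hl : 0 < l)
    (hM : ∀ k : ℕ, ‖lam (k + 1) - (Real.pi / (2 * l) : ℂ) ^ 2 * ((k : ℂ) + 1) ^ 2‖ ≤ M) :
    Continuous (prodDelta d l lam) := by
  unfold prodDelta
  exact (by fun_prop : Continuous fun z => (l * d ^ 2 * (z - lam 0) : ℂ)).mul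
    (continuous_tprod_prodFactor hl hM)

end Convergence

theorem continuous_tildeDelta (d l : ℝ) (u : ℂ) : Continuous (tildeDelta d l u) := by
  unfold tildeDelta
  have := continuous_sinQuot l
  fun_prop

/-- The asymptotics of `lam n` itself in place of its square root, with the scale `(π / (2 l))²`
factored out and the index shifted to `k = n - 1`. -/
theorem exists_eq_of_hasSpectralAsymptotics {d l : ℝ} (hd : 0 < d) (hl : 0 < l) {u : ℂ}
    {lam : ℕ → ℂ} (hlam : HasSpectralAsymptotics d l u lam) :
    ∃ κ : ℕ → ℂ, Memℓp κ 2 ∧ ∀ k : ℕ,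
      lam (k + 1) = (Real.pi / (2 * l) : ℂ) ^ 2 * (((k : ℂ) + 1) ^ 2 + (8 * l / (d * Real.pi ^ 2)
        + 16 * u * l ^ 2 / Real.pi ^ 3 *
          (Complex.sin (((k : ℂ) + 1) * (Real.pi / 2)) / ((k : ℂ) + 1))
        + κ k / ((k : ℂ) + 1))) := by
  obtain ⟨μ, hμ, h⟩ := hlam
  have hl' : (l : ℂ) ≠ 0 := by exact_mod_cast hl.ne'
  have hd' : (d : ℂ) ≠ 0 := by exact_mod_cast hd.ne'
  have hpi : (Real.pi : ℂ) ≠ 0 := by exact_mod_cast Real.pi_ne_zero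
  set δ : ℕ → ℂ := fun k => Complex.sin (((k : ℂ) + 1) * (Real.pi / 2)) with hδ
  have hδ1 : ∀ k, ‖δ k‖ ≤ 1 := norm_sin_mul_half_pi_le_one
  obtain ⟨Cμ, hCμ⟩ := exists_norm_le_of_memℓp_two hμ
  -- `ρ_n = π n / (2 l) + g k / n` with `n = k + 1` and `g` bounded
  set g : ℕ → ℂ := fun k => 2 / (d * Real.pi) + 4 * l * δ k * u / (Real.pi ^ 2 * ((k : ℂ) + 1)) +
    μ (k + 1) / ((k : ℂ) + 1) with hg
  set Cg := ‖(2 / (d * Real.pi) : ℂ)‖ + ‖4 * l * u / Real.pi ^ 2‖ + Cμ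
  have hCμ0 : 0 ≤ Cμ := (norm_nonneg _).trans (hCμ 0)
  have hgC : ∀ k, ‖g k‖ ≤ Cg := fun k => by
    have e : g k = 2 / (d * Real.pi) + 4 * l * u / Real.pi ^ 2 * (δ k * ((k : ℂ) + 1)⁻¹) +
        μ (k + 1) * ((k : ℂ) + 1)⁻¹ := by
      simp only [hg, div_eq_mul_inv, mul_inv]; ring
    rw [e]
    refine (norm_add₃_le).trans ?_
    have h1 : ‖δ k * ((k : ℂ) + 1)⁻¹‖ ≤ 1 := by
      rw [norm_mul, norm_inv_natCast_add_one]
      exact mul_le_one₀ (hδ1 k) (by positivity) (inv_natCast_add_one_le_one k)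
    have h2 : ‖μ (k + 1) * ((k : ℂ) + 1)⁻¹‖ ≤ Cμ := by
      rw [norm_mul, norm_inv_natCast_add_one]
      exact (mul_le_of_le_one_right (norm_nonneg _) (inv_natCast_add_one_le_one k)).trans (hCμ _)
    rw [norm_mul (4 * l * u / Real.pi ^ 2 : ℂ)]
    have := mul_le_of_le_one_right (norm_nonneg (4 * l * u / Real.pi ^ 2 : ℂ)) h1
    linarith
  have hμ' : Memℓp (fun k => μ (k + 1)) 2 := by
    rw [memℓp_two_iff] at hμ ⊢
    exact (summable_nat_add_iff 1).2 hμ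
  have hg2 : Memℓp (fun k : ℕ => g k ^ 2 * ((k : ℂ) + 1)⁻¹) 2 := by
    rw [memℓp_two_iff]
    refine (summable_inv_add_one_sq.mul_left ((Cg ^ 2) ^ 2)).of_nonneg_of_le
      (fun _ => by positivity) fun k => ?_
    rw [norm_mul, mul_pow, norm_inv_natCast_add_one, inv_pow, norm_pow]
    gcongr
    exact hgC k
  refine ⟨(4 * l / Real.pi : ℂ) • (fun k => μ (k + 1)) +
    (4 * l ^ 2 / Real.pi ^ 2 : ℂ) • (fun k : ℕ => g k ^ 2 * ((k : ℂ) + 1)⁻¹),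
    (hμ'.const_smul _).add (hg2.const_smul _), fun k => ?_⟩
  have hk : (k : ℂ) + 1 ≠ 0 := Nat.cast_add_one_ne_zero k
  have hsin : (Real.sin (Real.pi * ((k + 1 : ℕ) : ℝ) / 2) : ℂ) = δ k := by
    simp only [hδ]; push_cast; congr 1; ring
  rw [h (k + 1) (Nat.le_add_left 1 k), hsin]
  simp only [Pi.add_apply, Pi.smul_apply, smul_eq_mul]
  push_cast
  have e : (Real.pi : ℂ) * (k + 1) / (2 * l) + 2 / (d * Real.pi * (k + 1)) +
      4 * l * δ k * u / (Real.pi ^ 2 * ((k : ℂ) + 1) ^ 2) + μ (k + 1) / ((k : ℂ) + 1) ^ 2 =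
      Real.pi * (k + 1) / (2 * l) + g k / (k + 1) := by
    simp only [hg]; field_simp; ring
  have e2 : μ (k + 1) = ((k : ℂ) + 1) * (g k - 2 / (d * Real.pi) -
      4 * l * δ k * u / (Real.pi ^ 2 * ((k : ℂ) + 1))) := by
    simp only [hg]; field_simp; ring
  rw [e, e2, show Complex.sin (((k : ℂ) + 1) * (Real.pi / 2)) = δ k from rfl]
  generalize g k = G
  generalize δ k = D
  field_simp
  ring

/-- The expansion of `exists_tendsto_prod_partial_fraction` for `α k` of the shape that the spectral
asymptotics give. The constant `A` sums to the cotangent and the coefficient `b` to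
`sin (π x / 2) / sin (π x)`; the remaining residues are `ε k / (k + 1)` with `ε ∈ ℓ²`. -/
theorem exists_prod_remainder {A b w : ℂ} {κ α : ℕ → ℂ} (hκ : Memℓp κ 2)
    (hα : ∀ k, α k = A + b * (Complex.sin (((k : ℂ) + 1) * (Real.pi / 2)) / ((k : ℂ) + 1))
        + κ k / ((k : ℂ) + 1)) :
    ∃ (G : ℂ) (ε : ℕ → ℂ), Memℓp ε 2 ∧ ∀ x : ℂ, Complex.sin (Real.pi * x) ≠ 0 →
      Summable (fun k : ℕ => ε k * ((k : ℂ) + 1) * (((k : ℂ) + 1) ^ 2 - x ^ 2)⁻¹) ∧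
      Tendsto (fun K => (x ^ 2 - w) * ∏ m ∈ range K, (1 + α m / (((m : ℂ) + 1) ^ 2 - x ^ 2))) atTop
        (𝓝 (x ^ 2 + G - A * (Real.pi * x * Complex.cos (Real.pi * x) /
          (2 * Complex.sin (Real.pi * x))) + b * (Real.pi * Complex.sin (x * (Real.pi / 2)) /
          (2 * Complex.sin (Real.pi * x))) +
          ∑' k : ℕ, ε k * ((k : ℂ) + 1) * (((k : ℂ) + 1) ^ 2 - x ^ 2)⁻¹)) := by
  set δ : ℕ → ℂ := fun k => Complex.sin (((k : ℂ) + 1) * (Real.pi / 2)) with hδ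
  have hδ1 : ∀ k, ‖δ k‖ ≤ 1 := norm_sin_mul_half_pi_le_one
  obtain ⟨Cκ, hCκ⟩ := exists_norm_le_of_memℓp_two hκ
  have hk0 : ∀ k : ℕ, (k : ℂ) + 1 ≠ 0 := fun k =>
    Nat.cast_add_one_ne_zero k
  have hαA : ∀ m : ℕ, ‖α m - A‖ ≤ (‖b‖ + Cκ) * (m + 1 : ℝ)⁻¹ := fun m => by
    have e : α m - A = (b * δ m + κ m) * ((m : ℂ) + 1)⁻¹ := by rw [hα]; ring
    rw [e, norm_mul, norm_inv_natCast_add_one]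
    gcongr
    refine (norm_add_le _ _).trans (add_le_add ?_ (hCκ m))
    rw [norm_mul]
    exact mul_le_of_le_one_right (norm_nonneg _) (hδ1 m)
  obtain ⟨G₀, e, C, heC, hlim⟩ := exists_tendsto_prod_partial_fraction hαA w
  set ε : ℕ → ℂ := κ + fun k : ℕ => ((k : ℂ) + 1) * (e k - α k) with hε
  have heε : ∀ k, e k = A + b * (δ k / ((k : ℂ) + 1)) + ε k / ((k : ℂ) + 1) := fun k => by
    have := hk0 k
    have h1 : α k = A + b * (δ k / ((k : ℂ) + 1)) + κ k / ((k : ℂ) + 1) := hα k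
    simp only [hε, Pi.add_apply]
    field_simp at h1 ⊢
    linear_combination h1
  have hε2 : Memℓp ε 2 := by
    refine hκ.add (memℓp_two_iff.2 ?_)
    have hs : Summable fun k : ℕ => C ^ 2 * (1 / |(k : ℝ) + 1| ^ (3 / 2 : ℝ)) :=
      ((Real.summable_one_div_nat_add_rpow 1 (3 / 2)).2 (by norm_num)).mul_left _
    refine hs.of_nonneg_of_le (fun _ => by positivity) fun k => ?_
    have hN : 0 < (k : ℝ) + 1 := by positivity
    rw [norm_mul, norm_natCast_add_one, abs_of_pos hN]
    calc (((k : ℝ) + 1) * ‖e k - α k‖) ^ 2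
        ≤ (((k : ℝ) + 1) * (C * (k + 1 : ℝ) ^ (-(7 / 4) : ℝ))) ^ 2 := by
          gcongr; exact heC k
      _ = C ^ 2 * (((k : ℝ) + 1) ^ (2 : ℝ) * ((k + 1 : ℝ) ^ (-(7 / 4) : ℝ)) ^ (2 : ℝ)) := by
          simp only [Real.rpow_ofNat]; ring
      _ = _ := by
          rw [← Real.rpow_mul hN.le, ← Real.rpow_add hN, one_div, ← Real.rpow_neg hN.le]
          norm_num
  have hf : Summable fun k : ℕ => ε k / ((k : ℂ) + 1) := by
    have hs := ((memℓp_two_iff.1 hε2).add summable_inv_add_one_sq)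
    refine Summable.of_norm_bounded hs fun k => ?_
    rw [div_eq_mul_inv, norm_mul, norm_inv_natCast_add_one, ← inv_pow]
    nlinarith [sq_nonneg (‖ε k‖ - ((k : ℝ) + 1)⁻¹), sq_nonneg (‖ε k‖), sq_nonneg ((k : ℝ) + 1)⁻¹]
  refine ⟨G₀ + A / 2 - b * Real.pi / 4 - ∑' k : ℕ, ε k / ((k : ℂ) + 1), ε, hε2, fun x hx => ?_⟩
  have hx' := sin_pi_mul_ne_zero_iff.1 hx
  have hx0 : x ≠ 0 := by simpa using hx' 0
  have hnode := sq_natCast_add_one_ne_sq hx'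
  have h1 := (hasSum_inv_sq_sub_sq hx).mul_left A
  have h2 := (hasSum_sin_half_div hx).mul_left b
  obtain ⟨Cε, hCε⟩ := exists_norm_le_of_memℓp_two hε2
  have h3 : Summable fun k : ℕ => ε k / ((k : ℂ) + 1) * (((k : ℂ) + 1) ^ 2 - x ^ 2)⁻¹ := by
    refine Summable.of_norm_bounded ((summable_norm_inv_sq_sub (x ^ 2)).mul_left Cε) fun k => ?_
    rw [norm_mul, div_eq_mul_inv, norm_mul, norm_inv_natCast_add_one]
    gcongr
    exact (mul_le_of_le_one_right (norm_nonneg _)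
      (inv_natCast_add_one_le_one k)).trans (hCε k)
  -- `N² / (N² - x²) = 1 + x² / (N² - x²)`; the first term only contributes to the constant `G`
  have h4 : ∀ k : ℕ, ε k * ((k : ℂ) + 1) * (((k : ℂ) + 1) ^ 2 - x ^ 2)⁻¹ =
      ε k / ((k : ℂ) + 1) + x ^ 2 * (ε k / ((k : ℂ) + 1) * (((k : ℂ) + 1) ^ 2 - x ^ 2)⁻¹) := by
    intro k
    have := hk0 k
    have := sub_ne_zero.2 (hnode k)
    field_simp
    ring
  have h5 : Summable fun k : ℕ => ε k * ((k : ℂ) + 1) * (((k : ℂ) + 1) ^ 2 - x ^ 2)⁻¹ := by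
    simp_rw [h4]
    exact hf.add (h3.mul_left _)
  refine ⟨h5, ?_⟩
  have h6 : ∑' k : ℕ, ε k * ((k : ℂ) + 1) * (((k : ℂ) + 1) ^ 2 - x ^ 2)⁻¹ =
      ∑' k : ℕ, ε k / ((k : ℂ) + 1) +
      x ^ 2 * ∑' k : ℕ, ε k / ((k : ℂ) + 1) * (((k : ℂ) + 1) ^ 2 - x ^ 2)⁻¹ := by
    simp_rw [h4]
    rw [hf.tsum_add (h3.mul_left _), tsum_mul_left]
  have h7 : ∑' n : ℕ, e n / (((n : ℂ) + 1) ^ 2 - x ^ 2) =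
      A * (1 / (2 * x ^ 2) - Real.pi * Complex.cos (Real.pi * x) /
        (2 * x * Complex.sin (Real.pi * x))) +
      b * (Real.pi * Complex.sin (x * (Real.pi / 2)) / (2 * x ^ 2 * Complex.sin (Real.pi * x))
        - Real.pi / (4 * x ^ 2)) +
      ∑' k : ℕ, ε k / ((k : ℂ) + 1) * (((k : ℂ) + 1) ^ 2 - x ^ 2)⁻¹ := by
    refine (((h1.add h2).add h3.hasSum).congr_fun fun k => ?_).tsum_eq
    rw [heε]
    ring
  convert hlim (x ^ 2) hnode using 2
  rw [h6, h7]
  generalize Complex.sin (Real.pi * x) = S at hx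
  field_simp
  ring

theorem tendsto_prod_one_sub_div_sq {x : ℂ} (hx : x ≠ 0) :
    Tendsto (fun K => ∏ m ∈ range K, (1 - x ^ 2 / ((m : ℂ) + 1) ^ 2)) atTop
      (𝓝 (Complex.sin (Real.pi * x) / (Real.pi * x))) := by
  have hpi : (Real.pi : ℂ) ≠ 0 := by exact_mod_cast Real.pi_ne_zero
  refine ((Complex.tendsto_euler_sin_prod x).div_const (Real.pi * x)).congr fun K => ?_
  rw [mul_div_cancel_left₀ _ (mul_ne_zero hpi hx)]

/-! ### The representation of the product -/

theorem dense_setOf_sin_pi_mul_ne_zero : Dense {x : ℂ | Complex.sin (Real.pi * x) ≠ 0} := by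
  have h : {x : ℂ | Complex.sin (Real.pi * x) ≠ 0} = (Set.range fun n : ℤ => (n : ℂ))ᶜ := by
    ext x
    rw [Set.mem_ofPred_eq, sin_pi_mul_ne_zero_iff]
    simp [eq_comm]
  rw [h]
  exact (Set.countable_range _).dense_compl ℝ

theorem theorem3 (d l : ℝ) (hd : 0 < d) (hl : 0 < l) (u : ℂ) (lam : ℕ → ℂ)
    (hlam : HasSpectralAsymptotics d l u lam) :
    (∀ z : ℂ, Multipliable (prodFactor l lam z)) ∧
    ∃ (C₀ : ℂ) (W : ℝ → ℂ),
      MemLp W 2 (volume.restrict (Set.Ioo 0 (2 * l))) ∧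
      ∀ ρ : ℂ, prodDelta d l lam (ρ ^ 2) =
        tildeDelta d l u ρ + C₀ * sinQuot (2 * l) ρ
          + ∫ t in (0 : ℝ)..(2 * l), W t * (sinQuot t ρ / 2) := by
  have hl' : (l : ℂ) ≠ 0 := by exact_mod_cast hl.ne'
  have hd' : (d : ℂ) ≠ 0 := by exact_mod_cast hd.ne'
  have hpi : (Real.pi : ℂ) ≠ 0 := by exact_mod_cast Real.pi_ne_zero
  have hL : 0 < 2 * l := by positivity
  have hk0 : ∀ k : ℕ, (k : ℂ) + 1 ≠ 0 := Nat.cast_add_one_ne_zero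
  obtain ⟨κ, hκ, hκlam⟩ := exists_eq_of_hasSpectralAsymptotics hd hl hlam
  set c : ℂ := (Real.pi / (2 * l) : ℂ) ^ 2 with hc
  have hc0 : c ≠ 0 := pow_ne_zero 2 (div_ne_zero hpi (mul_ne_zero two_ne_zero hl'))
  set A : ℂ := 8 * l / (d * Real.pi ^ 2) with hA
  set b : ℂ := 16 * u * l ^ 2 / Real.pi ^ 3 with hb
  set α : ℕ → ℂ := fun k => A + b * (Complex.sin (((k : ℂ) + 1) * (Real.pi / 2)) / ((k : ℂ) + 1))
        + κ k / ((k : ℂ) + 1) with hα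
  have hlamα : ∀ k : ℕ, lam (k + 1) = c * (((k : ℂ) + 1) ^ 2 + α k) := hκlam
  obtain ⟨M, hM⟩ : ∃ M, ∀ k : ℕ, ‖lam (k + 1) - c * ((k : ℂ) + 1) ^ 2‖ ≤ M := by
    obtain ⟨Cκ, hCκ⟩ := exists_norm_le_of_memℓp_two hκ
    refine ⟨‖c‖ * (‖A‖ + (‖b‖ + Cκ)), fun k => ?_⟩
    have hN : ‖((k : ℂ) + 1)⁻¹‖ ≤ 1 :=
      (norm_inv_natCast_add_one k).trans_le (inv_natCast_add_one_le_one k)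
    have hs := norm_sin_mul_half_pi_le_one k
    have e : lam (k + 1) - c * ((k : ℂ) + 1) ^ 2 = c * (A +
        (b * Complex.sin (((k : ℂ) + 1) * (Real.pi / 2)) + κ k) * ((k : ℂ) + 1)⁻¹) := by
      rw [hlamα]; simp only [hα]; ring
    rw [e, norm_mul]
    gcongr
    refine (norm_add_le _ _).trans (add_le_add le_rfl ?_)
    rw [norm_mul]
    refine (mul_le_of_le_one_right (norm_nonneg _) hN).trans ?_
    refine (norm_add_le _ _).trans (add_le_add ?_ (hCκ k))
    rw [norm_mul]
    exact mul_le_of_le_one_right (norm_nonneg _) hs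
  have hmult := multipliable_prodFactor hl hM
  refine ⟨hmult, ?_⟩
  obtain ⟨G, ε, hε, hmain⟩ := exists_prod_remainder (α := α) (w := lam 0 / c) hκ fun k => rfl
  -- The sign and the factor are forced by `integral_sin_node_mul_sin`.
  set w : ℕ → ℂ := fun k => (-1) ^ k * (2 * l * d ^ 2 * c ^ 2 / Real.pi) * ε k with hw
  have hw2 : Memℓp w 2 := by
    rw [memℓp_two_iff] at hε ⊢
    refine (hε.mul_left (‖(2 * l * d ^ 2 * c ^ 2 / Real.pi : ℂ)‖ ^ 2)).congr fun k => ?_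
    simp only [hw, norm_mul, norm_pow, norm_neg, norm_one, one_pow, one_mul, mul_pow]
  obtain ⟨W, hW, hWsum⟩ := exists_memLp_hasSum_sine hL hw2
  refine ⟨d ^ 2 * c * G / 2, W, hW, ?_⟩
  -- Both sides are continuous in `ρ`, so it suffices to treat `ρ = π x / (2 l)` with
  -- `sin (π x) ≠ 0`.
  suffices h : ∀ x : ℂ, Complex.sin (Real.pi * x) ≠ 0 →
      prodDelta d l lam ((Real.pi / (2 * l) * x) ^ 2) =
        tildeDelta d l u (Real.pi / (2 * l) * x)
          + d ^ 2 * c * G / 2 * sinQuot (2 * l) (Real.pi / (2 * l) * x)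
          + ∫ t in (0 : ℝ)..(2 * l), W t * (sinQuot t (Real.pi / (2 * l) * x) / 2) by
    have hx : Continuous fun x : ℂ => (Real.pi / (2 * l) * x : ℂ) := by fun_prop
    have hcont := Continuous.ext_on dense_setOf_sin_pi_mul_ne_zero
      ((continuous_prodDelta d hl hM).comp (hx.pow 2))
      ((((continuous_tildeDelta d l u).comp hx).add
        (((continuous_sinQuot (2 * l)).comp hx).const_mul (d ^ 2 * c * G / 2))).add
        ((continuous_integral_mul_sinQuot hL hW).comp hx)) h
    intro ρ
    have h1 := congrFun hcont (2 * l / Real.pi * ρ)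
    have e : (Real.pi / (2 * l) * (2 * l / Real.pi * ρ) : ℂ) = ρ := by field_simp
    simpa [e] using h1
  intro x hx
  have hx' := sin_pi_mul_ne_zero_iff.1 hx
  have hx0 : x ≠ 0 := by simpa using hx' 0
  have hnode := fun n => sub_ne_zero.2 (sq_natCast_add_one_ne_sq hx' n)
  set ρ : ℂ := Real.pi / (2 * l) * x with hρ
  have hρ0 : ρ ≠ 0 := mul_ne_zero (div_ne_zero hpi (mul_ne_zero two_ne_zero hl')) hx0
  have hρ2 : ρ ^ 2 = c * x ^ 2 := by rw [hρ, mul_pow]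
  have hsin2 : Complex.sin (ρ * ((2 * l : ℝ) : ℂ)) = Complex.sin (Real.pi * x) := by
    congr 1; rw [hρ]; push_cast; field_simp
  obtain ⟨hT, hlim⟩ := hmain x hx
  set T := ∑' k : ℕ, ε k * ((k : ℂ) + 1) * (((k : ℂ) + 1) ^ 2 - x ^ 2)⁻¹
  have hprod : ((ρ ^ 2 - lam 0) * ∏' k, prodFactor l lam (ρ ^ 2) k) =
      c * ((Complex.sin (Real.pi * x) / (Real.pi * x)) *
      (x ^ 2 + G - A * (Real.pi * x * Complex.cos (Real.pi * x) /
          (2 * Complex.sin (Real.pi * x))) + b * (Real.pi * Complex.sin (x * (Real.pi / 2)) /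
          (2 * Complex.sin (Real.pi * x))) + T)) := by
    refine tendsto_nhds_unique ((hmult (ρ ^ 2)).hasProd.tendsto_prod_nat.const_mul _) ?_
    refine (((tendsto_prod_one_sub_div_sq hx0).mul hlim).const_mul c).congr fun K => ?_
    have e : ∀ m ∈ range K, prodFactor l lam (ρ ^ 2) m =
        (1 - x ^ 2 / ((m : ℂ) + 1) ^ 2) * (1 + α m / (((m : ℂ) + 1) ^ 2 - x ^ 2)) := by
      intro m _
      have h1 := hk0 m
      have h2 := hnode m
      rw [prodFactor_eq hl, ← hc, hlamα, hρ2]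
      field_simp
      ring
    rw [prod_congr rfl e, prod_mul_distrib, hρ2,
      show c * x ^ 2 - lam 0 = c * (x ^ 2 - lam 0 / c) by field_simp]
    ring
  have hint : ∫ t in (0 : ℝ)..(2 * l), W t * (sinQuot t ρ / 2) =
      l * d ^ 2 * c * (Complex.sin (Real.pi * x) / (Real.pi * x)) * T := by
    have h1 : ∀ t : ℝ, W t * (sinQuot t ρ / 2) = 1 / (2 * ρ) * (W t * Complex.sin (ρ * t)) := by
      intro t
      rw [sinQuot, if_neg hρ0]
      field_simp
    simp_rw [h1]
    rw [intervalIntegral.integral_const_mul]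
    have h2 : HasSum (fun k : ℕ => w k * ∫ t in (0 : ℝ)..(2 * l),
        Complex.sin (Real.pi * (k + 1) / (2 * l : ℝ) * t) * Complex.sin (ρ * t))
        (d ^ 2 * c * Complex.sin (Real.pi * x) * T) := by
      refine (hT.hasSum.mul_left _).congr_fun fun k => ?_
      have h3 := hnode k
      have h4 : (Real.pi * (k + 1) / (2 * l : ℝ) : ℂ) ^ 2 = c * ((k : ℂ) + 1) ^ 2 := by
        rw [hc]; push_cast; ring
      have h5 : ρ ^ 2 - (Real.pi * (k + 1) / (2 * l : ℝ) : ℂ) ^ 2 =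
          -(c * (((k : ℂ) + 1) ^ 2 - x ^ 2)) := by
        rw [h4, hρ2]; ring
      rw [integral_sin_node_mul_sin hL, h5, hsin2]
      · simp only [hw]
        have h6 : (-1 : ℂ) ^ k * (-1) ^ (k + 1) = -1 := by
          rw [pow_succ, ← mul_assoc, ← mul_pow]; simp
        push_cast
        generalize Complex.sin (Real.pi * x) = S
        have h7 : (-1) ^ k * (2 * l * d ^ 2 * c ^ 2 / Real.pi) * ε k *
          ((-1) ^ (k + 1) * (Real.pi * (k + 1) / (2 * l)) * S /
            -(c * (((k : ℂ) + 1) ^ 2 - x ^ 2))) = ((-1 : ℂ) ^ k * (-1) ^ (k + 1)) *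
            ((2 * l * d ^ 2 * c ^ 2 / Real.pi) * ε k *
          ((Real.pi * (k + 1) / (2 * l)) * S / -(c * (((k : ℂ) + 1) ^ 2 - x ^ 2)))) := by ring
        rw [h7, h6]
        field_simp
      · rw [← sub_ne_zero, h5]
        exact neg_ne_zero.2 (mul_ne_zero hc0 h3)
    rw [(hWsum ρ).unique h2, hρ]
    generalize Complex.sin (Real.pi * x) = S
    field_simp
  have hcos : Complex.cos (2 * ρ * l) = Complex.cos (Real.pi * x) := by
    congr 1; rw [hρ]; field_simp
  have hsin : Complex.sin (2 * ρ * l) = Complex.sin (Real.pi * x) := by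
    congr 1; rw [hρ]; field_simp
  have hsinl : Complex.sin (ρ * l) = Complex.sin (x * (Real.pi / 2)) := by
    congr 1; rw [hρ]; field_simp
  rw [prodDelta, mul_assoc, hprod, hint, tildeDelta, hcos, hsin, sinQuot, sinQuot, if_neg hρ0,
    if_neg hρ0, hsin2, hsinl, hA, hb, hρ]
  clear_value T
  generalize Complex.sin (Real.pi * x) = S at hx
  generalize Complex.cos (Real.pi * x) = Co
  generalize Complex.sin (x * (Real.pi / 2)) = Sl
  rw [hc]
  field_simp
  ring
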